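/- Let $(M,g)$ be a connected smooth ($C^\infty$) finite-dimensional Riemannian manifold without boundary (not assumed complete), and let $\operatorname{Isom}(M,g)$ be its full isometry group, that is, the group of all smooth diffeomorphisms of $M$ preserving $g$, with the compact-open topology. Let $\gamma:\mathbb{R}\to M$ be a geodesic parameterized with arc length. Suppose that for every $s\in\mathbb{R}$ there is an isometry $\eta(s)\in\operatorname{Isom}(M,g)$ such that $\eta(s)(\gamma(t))=\gamma(t+s)$ for all $t\in\mathbb{R}$ (no continuity and no group law is assumed for $s\mapsto\eta(s)$). Then the geodesic $\gamma$ is homogeneous, i.e. an orbit of a $1$-parameter isometry group: there are a $1$-parameter subgroup of $\operatorname{Isom}(M,g)$, that is, a continuous homomorphism $\psi:\mathbb{R}\to\operatorname{Isom}(M,g)$, and a point $x\in M$ such that $\gamma(\mathbb{R})=\{\psi(t)(x) : t\in\mathbb{R}\}$. -/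

import Mathlib

open Set Bundle
open scoped Manifold ContDiff Topology InnerProductSpace

noncomputable section

section RiemannianNotions

variable (n : ℕ) (M : Type*) [TopologicalSpace M]
  [ChartedSpace (EuclideanSpace ℝ (Fin n)) M] [IsManifold (𝓡 n) ∞ M]
  [RiemannianBundle (fun x : M => TangentSpace (𝓡 n) x)]

/-- The isometry group of a Riemannian manifold `(M, g)`, as a group of permutations of `M`: the
smooth diffeomorphisms `φ` of `M` with `φ^* g = g`. -/
def isomSubgroup : Subgroup (Equiv.Perm M) where
  carrier := {φ | ContMDiff (𝓡 n) (𝓡 n) ∞ φ ∧ ContMDiff (𝓡 n) (𝓡 n) ∞ φ.symm ∧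
    ∀ (x : M) (v w : TangentSpace (𝓡 n) x),
      ⟪mfderiv (𝓡 n) (𝓡 n) φ x v, mfderiv (𝓡 n) (𝓡 n) φ x w⟫_ℝ = ⟪v, w⟫_ℝ}
  one_mem' := by
    refine ⟨contMDiff_id, contMDiff_id, fun x v w => ?_⟩
    have h : mfderiv (𝓡 n) (𝓡 n) (⇑(1 : Equiv.Perm M)) x
        = ContinuousLinearMap.id ℝ (TangentSpace (𝓡 n) x) := mfderiv_id
    rw [h]
    rfl
  mul_mem' := by
    rintro φ χ ⟨hφ, hφ', hφg⟩ ⟨hχ, hχ', hχg⟩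
    refine ⟨hφ.comp hχ, hχ'.comp hφ', fun x v w => ?_⟩
    have h : mfderiv (𝓡 n) (𝓡 n) (⇑(φ * χ)) x
        = (mfderiv (𝓡 n) (𝓡 n) φ (χ x)).comp (mfderiv (𝓡 n) (𝓡 n) χ x) :=
      mfderiv_comp x ((hφ.mdifferentiable (by simp)) _) ((hχ.mdifferentiable (by simp)) _)
    rw [h]
    exact (hφg (χ x) _ _).trans (hχg x v w)
  inv_mem' := by
    rintro φ ⟨hφ, hφ', hφg⟩
    refine ⟨hφ', hφ, fun x v w => ?_⟩
    have h : (mfderiv (𝓡 n) (𝓡 n) φ (φ.symm x)).comp (mfderiv (𝓡 n) (𝓡 n) φ.symm x)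
        = mfderiv (𝓡 n) (𝓡 n) (φ ∘ φ.symm) x :=
      (mfderiv_comp x ((hφ.mdifferentiable (by simp)) _) ((hφ'.mdifferentiable (by simp)) _)).symm
    have key : ∀ (y : M) (a b : TangentSpace (𝓡 n) x)
        (T : TangentSpace (𝓡 n) x →L[ℝ] TangentSpace (𝓡 n) y)
        (f : M → M), f = id → ∀ hy : f x = y, HEq T (mfderiv (𝓡 n) (𝓡 n) f x) →
        ⟪T a, T b⟫_ℝ = ⟪a, b⟫_ℝ := by
      rintro y a b T f rfl rfl hT
      obtain rfl := eq_of_heq hT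
      rw [mfderiv_id]
      rfl
    have h2 := key (φ (φ.symm x)) v w
      ((mfderiv (𝓡 n) (𝓡 n) φ (φ.symm x)).comp (mfderiv (𝓡 n) (𝓡 n) φ.symm x))
      (φ ∘ φ.symm) (by funext z; simp) rfl (heq_of_eq h)
    exact (hφg (φ.symm x) _ _).symm.trans h2

/-- The full isometry group `Isom(M, g)`. -/
def Isom : Type _ := isomSubgroup n M

instance : Group (Isom n M) := inferInstanceAs (Group (isomSubgroup n M))

/-- The natural action of `Isom(M, g)` on `M`, that is `a • x = a x`. -/
instance : MulAction (Isom n M) M := inferInstanceAs (MulAction (isomSubgroup n M) M)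

variable {n M}

/-- An isometry as a continuous self-map of `M`. -/
def Isom.toContinuousMap (a : Isom n M) : C(M, M) where
  toFun x := a • x
  continuous_toFun := a.2.1.continuous

variable (n M)

/-- The topology of `Isom(M, g)` is the compact-open topology. -/
instance : TopologicalSpace (Isom n M) :=
  TopologicalSpace.induced Isom.toContinuousMap inferInstance

variable {M}

/-- The metric read in the chart at `x₀`: with `y` in the target of the chart,
`chartMetric n x₀ y v w` is `g(v, w)` at the point with coordinates `y`, for tangent
vectors with components `v` and `w`. -/
def chartMetric (x₀ : M) (y v w : EuclideanSpace ℝ (Fin n)) : ℝ :=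
  ⟪mfderiv (𝓡 n) (𝓡 n) (extChartAt (𝓡 n) x₀).symm y v,
    mfderiv (𝓡 n) (𝓡 n) (extChartAt (𝓡 n) x₀).symm y w⟫_ℝ

/-- The Christoffel symbols of the first kind of the Levi-Civita connection in the chart at `x₀`,
`Γ(u, v; w) = (∂_u g(v, w) + ∂_v g(u, w) - ∂_w g(u, v)) / 2 = g(∇_u v, w)` for vectors
`u`, `v`, `w` with constant components. -/
def christoffel (x₀ : M) (y u v w : EuclideanSpace ℝ (Fin n)) : ℝ :=
  (fderiv ℝ (fun z => chartMetric n x₀ z v w) y u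
    + fderiv ℝ (fun z => chartMetric n x₀ z u w) y v
    - fderiv ℝ (fun z => chartMetric n x₀ z u v) y w) / 2

/-- `γ : ℝ → M` is a geodesic: it is smooth and `∇_{γ'} γ' = 0`, that is, in local coordinates,
`g(c'', w) + Γ(c', c'; w) = 0` for all `w`, where `c` is the coordinate expression of `γ`. -/
def IsGeodesic (γ : ℝ → M) : Prop :=
  ContMDiff 𝓘(ℝ, ℝ) (𝓡 n) ∞ γ ∧
    ∀ (x₀ : M) (t : ℝ), γ t ∈ (extChartAt (𝓡 n) x₀).source →
      let c : ℝ → EuclideanSpace ℝ (Fin n) := fun s => extChartAt (𝓡 n) x₀ (γ s)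
      ∀ w : EuclideanSpace ℝ (Fin n),
        chartMetric n x₀ (c t) (deriv (deriv c) t) w
          + christoffel n x₀ (c t) (deriv c t) (deriv c t) w = 0

/-- `γ` is parameterized with arc length: `‖γ'(t)‖ = 1` for all `t`. -/
def IsArcLength (γ : ℝ → M) : Prop :=
  ∀ t : ℝ, ‖mfderiv 𝓘(ℝ, ℝ) (𝓡 n) γ t (1 : ℝ)‖ = 1

/-- `γ` is homogeneous: `γ(ℝ)` is an orbit of a 1-parameter subgroup `t ↦ ψ(t)` of the full
isometry group, that is, of a continuous homomorphism `ψ : ℝ → Isom(M, g)`. -/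
def IsHomogeneous (γ : ℝ → M) : Prop :=
  ∃ (ψ : Multiplicative ℝ →ₜ* Isom n M) (x : M),
    range γ = range (fun t : ℝ => ψ (Multiplicative.ofAdd t) • x)

end RiemannianNotions

end

noncomputable section

open Filter

/-! ### One-parameter subgroups as limits of powers -/

section OneParameter

variable {𝔸 : Type*} [NormedRing 𝔸] [NormedAlgebra ℝ 𝔸] [CompleteSpace 𝔸]

/-! Pair each translating isometry with its shift: the (a, s) with a(γ(t)) = γ(t + s) for all t form
a topological group G, `translationGroup`, on which s is a continuous, surjective, additive
function. (If γ is periodic, a alone does not determine s.) A continuous homomorphic section of s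
yields the required ψ, with ψ(t)(γ(0)) = γ(t).

The section exists because G is proper over ℝ and linear near the fibre s = 0. Both facts rest on
`hasFDerivAt_jet_of_isometry`: comparing Christoffel symbols expresses the second derivative of an
isometry through its 1-jet, so 1-jets solve a total differential equation. Hence limits of
isometries are smooth isometries and their differentials converge, which gives compactness of {|s| ≤
R} (`isCompact_translationGroup`); and a 1-jet at one point determines an isometry of a connected
manifold (`Isom.eq_of_fderiv_eq`). For the linear model, let A(g) be the differential of g at γ(0)
followed by parallel transport along γ from γ(s) back to γ(0). Isometries commute with parallel
transport, so A is multiplicative for small shifts, and A(g) = 1 with s(g) = 0 forces g = 1.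

The Lie-theoretic core, `exists_continuous_hom_section`, uses no Lie group structure on G. In the
fibres s = σ_m → 0 choose g_m with A(g_m) = exp(X_m) nearest to 1. Powers of g_m, rescaled by r_m =
‖X_m‖ + σ_m, converge to a one-parameter group ψ with s(ψ(t)) = τt. If τ were 0, multiplying g_m by
ψ(-r_m) would stay in the fibre and come closer to 1, against minimality. So τ ≠ 0, and
reparametrizing ψ gives the section. -/

lemma continuous_exp_real_algebra : Continuous (NormedSpace.exp : 𝔸 → 𝔸) := by
  let _ : NormedAlgebra ℚ 𝔸 := NormedAlgebra.restrictScalars ℚ ℝ 𝔸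
  exact NormedSpace.exp_continuous

lemma exp_add_smul_real_algebra (a b : ℝ) (X : 𝔸) :
    NormedSpace.exp ((a + b) • X) = NormedSpace.exp (a • X) * NormedSpace.exp (b • X) := by
  let _ : NormedAlgebra ℚ 𝔸 := NormedAlgebra.restrictScalars ℚ ℝ 𝔸
  rw [add_smul]
  exact NormedSpace.exp_add_of_commute (((Commute.refl X).smul_left a).smul_right b)

lemma exp_neg_mul_exp_real_algebra (X : 𝔸) :
    NormedSpace.exp (-X) * NormedSpace.exp X = 1 := by
  have := exp_add_smul_real_algebra (-1) 1 X
  simpa using this.symm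

/-- The exponential of a real Banach algebra has continuous local inverse at `1`. -/
lemma exists_local_log : ∃ l : 𝔸 → 𝔸, Tendsto l (𝓝 1) (𝓝 0) ∧
    ∀ᶠ y in 𝓝 (1 : 𝔸), NormedSpace.exp (l y) = y := by
  have h : HasStrictFDerivAt (NormedSpace.exp : 𝔸 → 𝔸)
      ((ContinuousLinearEquiv.refl ℝ 𝔸 : 𝔸 ≃L[ℝ] 𝔸) : 𝔸 →L[ℝ] 𝔸) 0 :=
    hasStrictFDerivAt_exp_zero
  refine ⟨h.localInverse, ?_, ?_⟩
  · simpa [NormedSpace.exp_zero] using h.localInverse_tendsto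
  · simpa [NormedSpace.exp_zero] using h.eventually_right_inverse

/-- Near `0` the exponential is bi-Lipschitz, and close to the identity. -/
lemma eventually_norm_exp_sub_exp_sub_le {c : ℝ} (hc : 0 < c) :
    ∃ δ > 0, ∀ x y : 𝔸, ‖x‖ < δ → ‖y‖ < δ →
      ‖NormedSpace.exp x - NormedSpace.exp y - (x - y)‖ ≤ c * ‖x - y‖ := by
  have h : HasStrictFDerivAt (NormedSpace.exp : 𝔸 → 𝔸) (1 : 𝔸 →L[ℝ] 𝔸) 0 :=
    hasStrictFDerivAt_exp_zero
  have h2 := h.isLittleO.def hc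
  obtain ⟨δ, hδ, hb⟩ := Metric.eventually_nhds_iff.1 h2
  refine ⟨δ, hδ, fun x y hx hy => ?_⟩
  simpa using hb (y := (x, y)) (by simpa [Prod.dist_eq] using ⟨hx, hy⟩)

variable {G : Type*} [Group G] {s : G → ℝ}

lemma additive_zpow (hs : ∀ g h, s (g * h) = s g + s h) (g : G) (k : ℤ) : s (g ^ k) = k * s g := by
  let S : G →* Multiplicative ℝ := MonoidHom.mk' (fun g => Multiplicative.ofAdd (s g))
    (fun a b => by rw [hs]; rfl)
  have h := map_zpow S g k
  have h2 : s (g ^ k) = k • s g := congrArg Multiplicative.toAdd h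
  simpa using h2

lemma additive_one (hs : ∀ g h, s (g * h) = s g + s h) : s 1 = 0 := by
  simpa using additive_zpow hs 1 0

lemma additive_inv (hs : ∀ g h, s (g * h) = s g + s h) (g : G) : s g⁻¹ = - s g := by
  simpa using additive_zpow hs g (-1)

variable {A : G → 𝔸} {ε : ℝ}

/-- Intermediate powers have smaller |s|, so local multiplicativity applies at every step of the
induction. For a negative exponent, A of the inverse power is a left inverse of A(g ^ m) and the
exponential is a right inverse, so the two agree. -/
lemma localHom_zpow (hs : ∀ g h, s (g * h) = s g + s h)
    (hA1 : A 1 = 1)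
    (hA : ∀ g h, |s g| < ε → |s h| < ε → |s (g * h)| < ε → A (g * h) = A g * A h)
    {g : G} {X : 𝔸} (hX : A g = NormedSpace.exp X) (k : ℤ) (hk : |k * s g| < ε) :
    A (g ^ k) = NormedSpace.exp ((k : ℝ) • X) := by
  have hε : 0 < ε := (abs_nonneg _).trans_lt hk
  have nat : ∀ m : ℕ, |m * s g| < ε → A (g ^ m) = NormedSpace.exp ((m : ℝ) • X) := by
    intro m
    induction m with
    | zero => intro _; simp [hA1]
    | succ m ih =>
      intro hm
      have h0 : |(m : ℝ) * s g| ≤ |((m + 1 : ℕ) : ℝ) * s g| := by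
        rw [abs_mul, abs_mul]
        gcongr
        exact m.le_succ
      have h1 : |s g| ≤ |((m + 1 : ℕ) : ℝ) * s g| := by
        rw [abs_mul]
        apply le_mul_of_one_le_left (abs_nonneg _)
        rw [abs_of_nonneg (by positivity)]
        push_cast; linarith [(Nat.cast_nonneg m : (0 : ℝ) ≤ m)]
      have e : ∀ j : ℕ, s (g ^ j) = j * s g := fun j => by
        simpa using additive_zpow hs g (j : ℤ)
      rw [pow_succ, hA _ _ (by rw [e]; exact h0.trans_lt hm) (h1.trans_lt hm)
        (by rw [← pow_succ, e]; exact hm), ih (h0.trans_lt hm), hX]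
      push_cast
      rw [exp_add_smul_real_algebra, one_smul]
  obtain ⟨m, rfl | rfl⟩ := k.eq_nat_or_neg
  · simpa using nat m (by simpa using hk)
  · have hk' : |m * s g| < ε := by simpa using hk
    have e : s (g ^ m) = m * s g := by simpa using additive_zpow hs g (m : ℤ)
    have h1 : A ((g ^ m)⁻¹) * A (g ^ m) = 1 := by
      rw [← hA _ _ (by rw [additive_inv hs, e, abs_neg]; exact hk') (by rw [e]; exact hk')
        (by simpa [additive_one hs] using hε), inv_mul_cancel, hA1]
    have h2 : A (g ^ m) * NormedSpace.exp (-((m : ℝ) • X)) = 1 := by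
      rw [nat m hk']
      simpa using exp_neg_mul_exp_real_algebra (-((m : ℝ) • X))
    simpa using left_inv_eq_right_inv h1 h2

variable [TopologicalSpace G] [ContinuousMul G] [T2Space G]

/-- The limit of powers `g i ^ ⌊t N i⌋` of elements `g i = exp (X i)` that converge to `1` is a
one-parameter subgroup. -/
lemma exists_oneParameter_of_tendsto (hs : ∀ g h, s (g * h) = s g + s h) (hsc : Continuous s)
    (hcomp : ∀ R, IsCompact {g | |s g| ≤ R}) (hε : 0 < ε) (hA1 : A 1 = 1)
    (hA : ∀ g h, |s g| < ε → |s h| < ε → |s (g * h)| < ε → A (g * h) = A g * A h)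
    (hAc : ∀ g, |s g| < ε → ContinuousAt A g) (hinj : ∀ g, s g = 0 → A g = 1 → g = 1)
    {ι : Type*} (l : Ultrafilter ι) {g : ι → G} {X : ι → 𝔸} {N : ι → ℝ} {σ : ℝ} {Y : 𝔸}
    (hg : Tendsto g l (𝓝 1)) (hN : Tendsto N l atTop) (hX : ∀ᶠ i in l, A (g i) = NormedSpace.exp (X i))
    (hσ : Tendsto (fun i => N i * s (g i)) l (𝓝 σ)) (hY : Tendsto (fun i => N i • X i) l (𝓝 Y)) :
    ∃ ψ : Multiplicative ℝ →* G, Continuous ψ ∧ (∀ t, s (ψ (.ofAdd t)) = t * σ) ∧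
      ∀ t, |t * σ| < ε → A (ψ (.ofAdd t)) = NormedSpace.exp (t • Y) := by
  have hNpos : ∀ᶠ i in l, 0 < N i := hN.eventually_gt_atTop 0
  have hfl : ∀ t : ℝ, Tendsto (fun i => (⌊t * N i⌋ : ℝ) / N i) l (𝓝 t) := by
    intro t
    have h0 : Tendsto (fun i => t - (N i)⁻¹) l (𝓝 t) := by
      simpa using tendsto_const_nhds.sub (tendsto_inv_atTop_zero.comp hN)
    refine tendsto_of_tendsto_of_tendsto_of_le_of_le' h0 tendsto_const_nhds ?_ ?_
    · filter_upwards [hNpos] with i hi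
      rw [le_div_iff₀ hi, sub_mul, inv_mul_cancel₀ hi.ne']
      linarith [Int.lt_floor_add_one (t * N i)]
    · filter_upwards [hNpos] with i hi
      rw [div_le_iff₀ hi]
      exact Int.floor_le _
  have hs1 : ∀ t : ℝ, Tendsto (fun i => s (g i ^ ⌊t * N i⌋)) l (𝓝 (t * σ)) := by
    intro t
    refine ((hfl t).mul hσ).congr' ?_
    filter_upwards [hNpos] with i hi
    rw [additive_zpow hs]
    field_simp
  have hX1 : ∀ t : ℝ, Tendsto (fun i => (⌊t * N i⌋ : ℝ) • X i) l (𝓝 (t • Y)) := by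
    intro t
    refine ((hfl t).smul hY).congr' ?_
    filter_upwards [hNpos] with i hi
    rw [smul_smul, div_mul_cancel₀ _ hi.ne']
  -- Along an ultrafilter, compactness yields limits for all t at once, with no passage to
  -- subsequences.
  have hlim : ∀ t : ℝ, ∃ x, Tendsto (fun i => g i ^ ⌊t * N i⌋) l (𝓝 x) := by
    intro t
    have h1 : ∀ᶠ i in l, g i ^ ⌊t * N i⌋ ∈ {g | |s g| ≤ |t * σ| + 1} := by
      filter_upwards [(hs1 t).abs.eventually_lt_const (lt_add_one _)] with i hi using hi.le
    obtain ⟨x, -, hx⟩ := (hcomp _).ultrafilter_le_nhds' (l.map fun i => g i ^ ⌊t * N i⌋) h1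
    exact ⟨x, hx⟩
  choose ψ hψ using hlim
  have hψs : ∀ t, s (ψ t) = t * σ := fun t =>
    tendsto_nhds_unique ((hsc.tendsto _).comp (hψ t)) (hs1 t)
  have hψA : ∀ t, |t * σ| < ε → A (ψ t) = NormedSpace.exp (t • Y) := by
    intro t ht
    have h1 : Tendsto (fun i => A (g i ^ ⌊t * N i⌋)) l (𝓝 (A (ψ t))) :=
      (hAc (ψ t) (by rwa [hψs])).tendsto.comp (hψ t)
    refine tendsto_nhds_unique (h1.congr' ?_)
      ((continuous_exp_real_algebra.tendsto _).comp (hX1 t))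
    filter_upwards [hX, (hs1 t).abs.eventually_lt_const ht] with i hi hi2
    rw [additive_zpow hs] at hi2
    exact localHom_zpow hs hA1 hA hi _ hi2
  have hψadd : ∀ t u, ψ (t + u) = ψ t * ψ u := by
    intro t u
    have h1 := (hψ t).mul (hψ u)
    -- The floor is additive up to an error 0 or 1; the possible extra factor g i tends to 1.
    have hcases : ∀ᶠ i in l, g i ^ ⌊(t + u) * N i⌋ = g i ^ ⌊t * N i⌋ * g i ^ ⌊u * N i⌋ ∨
        g i ^ ⌊(t + u) * N i⌋ = g i ^ ⌊t * N i⌋ * g i ^ ⌊u * N i⌋ * g i := by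
      refine Eventually.of_forall fun i => ?_
      have a := Int.le_floor_add (t * N i) (u * N i)
      have b := Int.le_floor_add_floor (t * N i) (u * N i)
      rw [add_mul]
      rcases (by omega : ⌊t * N i + u * N i⌋ = ⌊t * N i⌋ + ⌊u * N i⌋ ∨
        ⌊t * N i + u * N i⌋ = ⌊t * N i⌋ + ⌊u * N i⌋ + 1) with h | h
      · left; rw [h, zpow_add]
      · right; rw [h, zpow_add, zpow_add, zpow_one]
    rcases Ultrafilter.eventually_or.1 hcases with h | h
    · exact tendsto_nhds_unique ((hψ (t + u)).congr' h) h1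
    · exact tendsto_nhds_unique ((hψ (t + u)).congr' h) (by simpa using h1.mul hg)
  let Ψ : Multiplicative ℝ →* G := MonoidHom.mk' (fun t => ψ t.toAdd) fun a b => hψadd _ _
  have hΨ0 : ψ 0 = 1 := map_one Ψ
  -- Every ultrafilter limit x of ψ at 0 has s x = 0 and A x = 1, and `hinj` identifies it with 1.
  have hcont0 : Tendsto ψ (𝓝 0) (𝓝 1) := by
    rw [tendsto_iff_ultrafilter]
    intro u hu
    have ht : Tendsto (fun t : ℝ => t) u (𝓝 0) := hu
    have htσ : Tendsto (fun t : ℝ => t * σ) u (𝓝 0) := by simpa using ht.mul_const σ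
    have h1 : ∀ᶠ t in u, ψ t ∈ {g | |s g| ≤ 1} := by
      have := htσ.abs
      rw [abs_zero] at this
      filter_upwards [this.eventually_lt_const one_pos] with t h
      simpa [hψs] using h.le
    obtain ⟨x, -, hx⟩ := (hcomp _).ultrafilter_le_nhds' (u.map ψ) h1
    have hx' : Tendsto ψ u (𝓝 x) := hx
    have sx : s x = 0 := tendsto_nhds_unique ((hsc.tendsto x).comp hx')
      (htσ.congr fun t => (hψs t).symm)
    have Ax : A x = 1 := by
      have h2 : Tendsto (fun t : ℝ => NormedSpace.exp (t • Y)) u (𝓝 (1 : 𝔸)) := by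
        have := (continuous_exp_real_algebra.tendsto _).comp (ht.smul_const Y)
        simpa [NormedSpace.exp_zero, Function.comp_def] using this
      refine tendsto_nhds_unique (((hAc x (by simpa [sx] using hε)).tendsto.comp hx')) (h2.congr' ?_)
      have := htσ.abs
      rw [abs_zero] at this
      filter_upwards [this.eventually_lt_const hε] with t h using (hψA t h).symm
    rw [hinj x sx Ax] at hx'
    exact hx'
  have hcont : Continuous ψ := by
    rw [continuous_iff_continuousAt]
    intro t
    have h1 : Tendsto (fun u => u - t) (𝓝 t) (𝓝 0) := by
      simpa using (continuous_sub_right t).tendsto t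
    have h2 := (hcont0.comp h1).const_mul (ψ t)
    rw [mul_one] at h2
    refine h2.congr fun u => ?_
    simp [← hψadd]
  exact ⟨Ψ, hcont.comp continuous_toAdd, hψs, hψA⟩

/-- A surjective additive function with compact fibers on a group that is, locally along this
function, linear, has a continuous homomorphic section. -/
theorem exists_continuous_hom_section [FiniteDimensional ℝ 𝔸]
    (hs : ∀ g h, s (g * h) = s g + s h) (hsc : Continuous s) (hsurj : Function.Surjective s)
    (hcomp : ∀ R, IsCompact {g | |s g| ≤ R}) (hε : 0 < ε) (hA1 : A 1 = 1)
    (hA : ∀ g h, |s g| < ε → |s h| < ε → |s (g * h)| < ε → A (g * h) = A g * A h)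
    (hAc : ∀ g, |s g| < ε → ContinuousAt A g) (hinj : ∀ g, s g = 0 → A g = 1 → g = 1) :
    ∃ ψ : Multiplicative ℝ →* G, Continuous ψ ∧ ∀ t, s (ψ (.ofAdd t)) = t := by
  let l : Ultrafilter ℕ := hyperfilter ℕ
  have hl : (l : Filter ℕ) ≤ atTop := by
    rw [← Nat.cofinite_eq_atTop]; exact hyperfilter_le_cofinite
  -- The shift by 2 keeps σ m strictly between 0 and ε, already for m = 0.
  let σ : ℕ → ℝ := fun m => ε / (m + 2)
  have hσpos : ∀ m, 0 < σ m := fun m => by positivity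
  have hσε : ∀ m, σ m < ε := fun m => by
    refine div_lt_self hε ?_
    linarith [(Nat.cast_nonneg m : (0 : ℝ) ≤ m)]
  have hσ0 : Tendsto σ l (𝓝 0) := by
    refine Tendsto.mono_left ?_ hl
    exact tendsto_const_nhds.div_atTop (tendsto_atTop_add_const_right _ _ tendsto_natCast_atTop_atTop)
  have habs : ∀ {m g}, s g = σ m → |s g| < ε := fun {m g} h => by
    rw [h, abs_of_pos (hσpos m)]; exact hσε m
  have hmin : ∀ m, ∃ g, s g = σ m ∧ ∀ h, s h = σ m → ‖A g - 1‖ ≤ ‖A h - 1‖ := by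
    intro m
    have hK : IsCompact {g | s g = σ m} := (hcomp ε).of_isClosed_subset
      (isClosed_eq hsc continuous_const) (fun g hg => (habs hg).le)
    obtain ⟨g, hg, hmin⟩ := hK.exists_isMinOn (f := fun g => ‖A g - 1‖) (hsurj (σ m))
      (fun g hg => (((hAc g (habs hg)).sub continuousAt_const).norm).continuousWithinAt)
    exact ⟨g, hg, fun h hh => hmin hh⟩
  choose g hgs hgmin using hmin
  -- Competitors in the same fibres: take any h m there, with limit h₀ in the kernel of s; then h m
  -- * h₀⁻¹ still lies in the fibre and tends to 1.
  have hAg : Tendsto (fun m => A (g m)) l (𝓝 1) := by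
    choose h hh using fun m => hsurj (σ m)
    obtain ⟨h₀, -, hh₀⟩ := (hcomp ε).ultrafilter_le_nhds' (l.map h)
      (Eventually.of_forall fun m => (habs (hh m)).le : ∀ᶠ m in l, h m ∈ {g | |s g| ≤ ε})
    have hh₀' : Tendsto h l (𝓝 h₀) := hh₀
    have sh₀ : s h₀ = 0 := tendsto_nhds_unique ((hsc.tendsto _).comp hh₀')
      (hσ0.congr fun m => (hh m).symm)
    have h1 : Tendsto (fun m => h m * h₀⁻¹) l (𝓝 1) := by
      simpa using hh₀'.mul_const h₀⁻¹
    have h2 : Tendsto (fun m => ‖A (h m * h₀⁻¹) - 1‖) l (𝓝 0) := by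
      have := (hAc 1 (by simpa [additive_one hs] using hε)).tendsto.comp h1
      rw [hA1] at this
      simpa using (this.sub_const 1).norm
    rw [tendsto_iff_norm_sub_tendsto_zero]
    refine squeeze_zero (fun _ => norm_nonneg _) (fun m => hgmin m _ ?_) h2
    rw [hs, additive_inv hs, sh₀, hh]; simp
  have hg1 : Tendsto g l (𝓝 1) := by
    obtain ⟨x, -, hx⟩ := (hcomp ε).ultrafilter_le_nhds' (l.map g)
      (Eventually.of_forall fun m => (habs (hgs m)).le : ∀ᶠ m in l, g m ∈ {g | |s g| ≤ ε})
    have hx' : Tendsto g l (𝓝 x) := hx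
    have sx : s x = 0 := tendsto_nhds_unique ((hsc.tendsto _).comp hx')
      (hσ0.congr fun m => (hgs m).symm)
    have Ax : A x = 1 :=
      tendsto_nhds_unique ((hAc x (by simpa [sx] using hε)).tendsto.comp hx') hAg
    rw [hinj x sx Ax] at hx'
    exact hx'
  obtain ⟨log, hlog0, hlog⟩ := exists_local_log (𝔸 := 𝔸)
  set X : ℕ → 𝔸 := fun m => log (A (g m)) with hXdef
  have hX0 : Tendsto X l (𝓝 0) := hlog0.comp hAg
  have hX : ∀ᶠ m in l, A (g m) = NormedSpace.exp (X m) := by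
    filter_upwards [hAg.eventually hlog] with m hm using hm.symm
  -- With this scale the pair (X m, σ m) / r m has ℓ¹-norm 1, so its limit (Y, 1 - ‖Y‖) cannot
  -- vanish.
  set r : ℕ → ℝ := fun m => ‖X m‖ + σ m with hr
  have hrpos : ∀ m, 0 < r m := fun m => by have := hσpos m; positivity
  have hr0 : Tendsto r l (𝓝 0) := by simpa using hX0.norm.add hσ0
  have hN : Tendsto (fun m => (r m)⁻¹) l atTop :=
    (tendsto_nhdsWithin_iff.2 ⟨hr0, Eventually.of_forall hrpos⟩).inv_tendsto_nhdsGT_zero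
  have hunit : ∀ m, ‖(r m)⁻¹ • X m‖ + (r m)⁻¹ * σ m = 1 := fun m => by
    rw [norm_smul, norm_inv, Real.norm_of_nonneg (hrpos m).le, ← mul_add]
    exact inv_mul_cancel₀ (hrpos m).ne'
  have : ProperSpace 𝔸 := FiniteDimensional.proper_real 𝔸
  obtain ⟨Y, -, hY⟩ := (isCompact_closedBall (0 : 𝔸) 1).ultrafilter_le_nhds'
    (l.map fun m => (r m)⁻¹ • X m) (Eventually.of_forall fun m => by
      have := hunit m
      have h2 : 0 < (r m)⁻¹ * σ m := mul_pos (inv_pos.2 (hrpos m)) (hσpos m)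
      simp only [Metric.mem_closedBall, dist_zero_right]
      linarith : ∀ᶠ m in l, (r m)⁻¹ • X m ∈ Metric.closedBall (0 : 𝔸) 1)
  replace hY : Tendsto (fun m => (r m)⁻¹ • X m) l (𝓝 Y) := hY
  have hτ : Tendsto (fun m => (r m)⁻¹ * s (g m)) l (𝓝 (1 - ‖Y‖)) := by
    refine (tendsto_const_nhds.sub hY.norm).congr fun m => ?_
    rw [hgs]; linarith [hunit m]
  obtain ⟨ψ, hψc, hψs, hψA⟩ := exists_oneParameter_of_tendsto hs hsc hcomp hε hA1 hA hAc hinj l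
    hg1 hN hX hτ hY
  set τ := 1 - ‖Y‖ with hτdef
  by_cases hτ0 : τ = 0
  -- Here ‖Y‖ = 1 and ψ takes values in the kernel of s. Thus ψ(-r m) * g m competes with g m in its
  -- fibre. Its distance from 1 is O(r m * ‖Z m - Y‖) = o(r m), while that of g m is at least r m *
  -- ‖Z m‖ / 2, of order r m.
  · exfalso
    have hY1 : ‖Y‖ = 1 := by linarith
    simp only [hτ0, mul_zero, abs_zero] at hψs hψA
    obtain ⟨δ₁, hδ₁, hexp1⟩ := eventually_norm_exp_sub_exp_sub_le (𝔸 := 𝔸) (c := 1 / 2) (by norm_num)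
    set Z : ℕ → 𝔸 := fun m => (r m)⁻¹ • X m with hZ
    have hXZ : ∀ m, X m = r m • Z m := fun m => by
      rw [hZ, smul_smul, mul_inv_cancel₀ (hrpos m).ne', one_smul]
    have hrY : Tendsto (fun m => r m • Y) l (𝓝 0) := by simpa using hr0.smul_const Y
    -- The unit need not have norm 1 in 𝔸; only a finite limit is needed.
    have hE : Tendsto (fun m => ‖NormedSpace.exp (-(r m • Y))‖) l (𝓝 ‖(1 : 𝔸)‖) := by
      have := (continuous_exp_real_algebra.tendsto _).comp hrY.neg
      simpa [Function.comp_def] using this.norm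
    have hlow : ∀ᶠ m in l, r m / 2 * ‖Z m‖ ≤ ‖A (g m) - 1‖ := by
      filter_upwards [hX0.norm.eventually_lt_const (by simpa using hδ₁), hX] with m hm hm2
      have h := hexp1 (X m) 0 hm (by simpa using hδ₁)
      rw [NormedSpace.exp_zero, sub_zero, ← hm2] at h
      have h2 : ‖X m‖ ≤ ‖A (g m) - 1‖ + ‖A (g m) - 1 - X m‖ := by
        have := norm_sub_le (A (g m) - 1) (A (g m) - 1 - X m)
        simpa using this
      have h3 : ‖X m‖ = r m * ‖Z m‖ := by
        rw [hXZ m, norm_smul, Real.norm_of_nonneg (hrpos m).le]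
      linarith
    have hup : ∀ᶠ m in l, ‖A (g m) - 1‖ ≤
        ‖NormedSpace.exp (-(r m • Y))‖ * (2 * (r m * ‖Z m - Y‖)) := by
      filter_upwards [hX0.norm.eventually_lt_const (by simpa using hδ₁),
        hrY.norm.eventually_lt_const (by simpa using hδ₁), hX] with m hm hm' hm2
      have e0 : s (ψ (.ofAdd (-r m)) * g m) = σ m := by rw [hs, hψs, hgs, zero_add]
      refine (hgmin m _ e0).trans ?_
      rw [hA _ _ (by rw [hψs]; simpa using hε) (habs (hgs m)) (habs e0), hψA _ hε, hm2, neg_smul]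
      have e1 : NormedSpace.exp (-(r m • Y)) * NormedSpace.exp (X m) - 1 =
          NormedSpace.exp (-(r m • Y)) * (NormedSpace.exp (X m) - NormedSpace.exp (r m • Y)) := by
        rw [mul_sub, exp_neg_mul_exp_real_algebra]
      rw [e1]
      refine (norm_mul_le _ _).trans ?_
      gcongr
      have h := hexp1 (X m) (r m • Y) hm hm'
      have h2 := norm_add_le (NormedSpace.exp (X m) - NormedSpace.exp (r m • Y) - (X m - r m • Y))
        (X m - r m • Y)
      rw [sub_add_cancel] at h2
      have h3 : ‖X m - r m • Y‖ = r m * ‖Z m - Y‖ := by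
        rw [hXZ m, ← smul_sub, norm_smul, Real.norm_of_nonneg (hrpos m).le]
      rw [← h3]
      linarith [norm_nonneg (X m - r m • Y)]
    have hcomb : ∀ᶠ m in l, ‖Z m‖ / 2 ≤ ‖NormedSpace.exp (-(r m • Y))‖ * (2 * ‖Z m - Y‖) := by
      filter_upwards [hlow, hup] with m h1 h2
      have h3 := h1.trans h2
      refine le_of_mul_le_mul_left ?_ (hrpos m)
      linarith
    have hlim : Tendsto (fun m => ‖NormedSpace.exp (-(r m • Y))‖ * (2 * ‖Z m - Y‖)) l (𝓝 0) := by
      have h0 : Tendsto (fun m => ‖Z m - Y‖) l (𝓝 0) := by simpa using (hY.sub_const Y).norm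
      simpa using hE.mul (h0.const_mul 2)
    have := le_of_tendsto_of_tendsto (hY.norm.div_const 2) hlim hcomb
    rw [hY1] at this
    norm_num at this
  · refine ⟨ψ.comp (AddMonoidHom.toMultiplicative (AddMonoidHom.mulRight τ⁻¹)), ?_, ?_⟩
    · exact hψc.comp (continuous_ofAdd.comp ((continuous_mul_const τ⁻¹).comp continuous_toAdd))
    · intro t
      have := hψs (t * τ⁻¹)
      rw [mul_assoc, inv_mul_cancel₀ hτ0, mul_one] at this
      exact this

end OneParameter

/-! ### Total differential equations: regularity, stability and limits -/

section TotalDifferentialEquation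

variable {E W : Type*} [NormedAddCommGroup E] [NormedSpace ℝ E]
  [NormedAddCommGroup W] [NormedSpace ℝ W] {Φ : E × W → E →L[ℝ] W} {Ω : Set (E × W)} {x₀ : E} {r : ℝ}
  {K : Set W}

/-- Solutions `J` of a smooth total differential equation `dJ = Φ(z, J)` are smooth. -/
lemma contDiffOn_of_totalDifferential {B : Set E} (hB : IsOpen B) (hΦ : ContDiffOn ℝ ∞ Φ Ω)
    {J : E → W} (hJ : ∀ z ∈ B, HasFDerivAt J (Φ (z, J z)) z) (hΩ : ∀ z ∈ B, (z, J z) ∈ Ω) :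
    ContDiffOn ℝ ∞ J B := by
  rw [contDiffOn_infty]
  intro k
  induction k with
  | zero =>
    exact contDiffOn_zero.2 fun z hz => (hJ z hz).continuousAt.continuousWithinAt
  | succ k ih =>
    push_cast
    rw [contDiffOn_succ_iff_fderiv_of_isOpen hB]
    refine ⟨fun z hz => (hJ z hz).differentiableAt.differentiableWithinAt, by simp, ?_⟩
    -- Bootstrap: if J is C^k, then so is its differential Φ(z, J z), hence J is C^(k+1).
    have h1 : ContDiffOn ℝ k (fun z => Φ (z, J z)) B :=
      (hΦ.of_le (by exact_mod_cast le_top)).comp (contDiffOn_id.prodMk ih) hΩ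
    exact h1.congr fun z hz => (hJ z hz).fderiv

lemma ContDiffOn.exists_lipschitzOnWith_of_isCompact {X Y : Type*} [NormedAddCommGroup X]
    [NormedSpace ℝ X] [NormedAddCommGroup Y] [NormedSpace ℝ Y] {f : X → Y} {U C : Set X}
    (hf : ContDiffOn ℝ ∞ f U) (hU : IsOpen U) (hC : IsCompact C) (hCc : Convex ℝ C) (hCU : C ⊆ U) :
    ∃ L : NNReal, LipschitzOnWith L f C := by
  have hcont : ContinuousOn (fderiv ℝ f) C :=
    (hf.continuousOn_fderiv_of_isOpen hU (by simp)).mono hCU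
  obtain ⟨B, hB⟩ := hC.exists_bound_of_continuousOn hcont
  refine ⟨B.toNNReal, hCc.lipschitzOnWith_of_nnnorm_fderiv_le
    (𝕜 := ℝ) (fun p hp => ?_) (fun p hp => ?_)⟩
  · exact (hf.differentiableOn (by simp)).differentiableAt (hU.mem_nhds (hCU hp))
  · rw [← NNReal.coe_le_coe]
    exact (hB p hp).trans (Real.le_coe_toNNReal B)

/-- Two solutions of a total differential equation stay as close as they are at the center. -/
lemma norm_sub_le_of_totalDifferential {L : NNReal}
    (hL : LipschitzOnWith L Φ (Metric.closedBall x₀ r ×ˢ K)) {J₁ J₂ : E → W}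
    (h₁ : ∀ z ∈ Metric.ball x₀ r, HasFDerivAt J₁ (Φ (z, J₁ z)) z ∧ J₁ z ∈ K)
    (h₂ : ∀ z ∈ Metric.ball x₀ r, HasFDerivAt J₂ (Φ (z, J₂ z)) z ∧ J₂ z ∈ K)
    {z : E} (hz : z ∈ Metric.ball x₀ r) :
    ‖J₁ z - J₂ z‖ ≤ ‖J₁ x₀ - J₂ x₀‖ * Real.exp (L * r) := by
  have hzr : ‖z - x₀‖ < r := by simpa [dist_eq_norm] using hz
  have hr : 0 < r := (norm_nonneg _).trans_lt hzr
  -- On the segment from the center to z the equation becomes an ODE with Lipschitz constant L * r,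
  -- since the velocity z - x₀ has norm below r. Grönwall on [0, 1] gives the bound.
  have hmem : ∀ t ∈ Icc (0 : ℝ) 1, x₀ + t • (z - x₀) ∈ Metric.ball x₀ r := by
    intro t ht
    rw [Metric.mem_ball, dist_eq_norm, add_sub_cancel_left, norm_smul, Real.norm_of_nonneg ht.1]
    exact (mul_le_of_le_one_left (norm_nonneg _) ht.2).trans_lt hzr
  have hline : ∀ t : ℝ, HasDerivAt (fun t : ℝ => x₀ + t • (z - x₀)) (z - x₀) t := fun t => by
    simpa using ((hasDerivAt_id t).smul_const (z - x₀)).const_add x₀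
  have key : ∀ {J : E → W}, (∀ z ∈ Metric.ball x₀ r, HasFDerivAt J (Φ (z, J z)) z ∧ J z ∈ K) →
      ∀ t ∈ Icc (0 : ℝ) 1, HasDerivAt (fun t : ℝ => J (x₀ + t • (z - x₀)))
        (Φ (x₀ + t • (z - x₀), J (x₀ + t • (z - x₀))) (z - x₀)) t := fun h t ht =>
    (h _ (hmem t ht)).1.comp_hasDerivAt t (hline t)
  have hlip : ∀ t ∈ Ico (0 : ℝ) 1, LipschitzOnWith (L * r.toNNReal)
      (fun w => Φ (x₀ + t • (z - x₀), w) (z - x₀)) K := by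
    intro t ht
    refine LipschitzOnWith.of_dist_le_mul fun w hw w' hw' => ?_
    have hm := Metric.ball_subset_closedBall (hmem t ⟨ht.1, ht.2.le⟩)
    have h := hL.dist_le_mul (_, w) ⟨hm, hw⟩ (_, w') ⟨hm, hw'⟩
    rw [Prod.dist_eq] at h
    simp only [dist_self, dist_nonneg, sup_of_le_right] at h
    rw [dist_eq_norm, ← sub_apply]
    refine (ContinuousLinearMap.le_opNorm _ _).trans ?_
    rw [← dist_eq_norm, NNReal.coe_mul, Real.coe_toNNReal r hr.le]
    calc _ ≤ (L * dist w w') * r := by gcongr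
      _ = _ := by ring
  have h := dist_le_of_trajectories_ODE_of_mem (s := fun _ => K) hlip
    (fun t ht => (key h₁ t ht).continuousAt.continuousWithinAt)
    (fun t ht => (key h₁ t ⟨ht.1, ht.2.le⟩).hasDerivWithinAt)
    (fun t ht => (h₁ _ (hmem t ⟨ht.1, ht.2.le⟩)).2)
    (fun t ht => (key h₂ t ht).continuousAt.continuousWithinAt)
    (fun t ht => (key h₂ t ⟨ht.1, ht.2.le⟩).hasDerivWithinAt)
    (fun t ht => (h₂ _ (hmem t ⟨ht.1, ht.2.le⟩)).2) le_rfl 1 (by simp)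
  simpa [dist_eq_norm, hr.le] using h

/-- Ultrafilter limits of solutions of a smooth total differential equation. -/
lemma exists_tendstoUniformlyOn_of_totalDifferential [ProperSpace E] (hr : 0 < r)
    (hΩ : IsOpen Ω) (hΦ : ContDiffOn ℝ ∞ Φ Ω) (hK : IsCompact K) (hKc : Convex ℝ K)
    (hsub : Metric.closedBall x₀ r ×ˢ K ⊆ Ω) {ι : Type*} (l : Ultrafilter ι) {J : ι → E → W}
    (hJ : ∀ᶠ i in l, ∀ z ∈ Metric.ball x₀ r, HasFDerivAt (J i) (Φ (z, J i z)) z ∧ J i z ∈ K) :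
    ∃ J' : E → W, TendstoUniformlyOn J J' l (Metric.ball x₀ r) ∧
      ∀ z ∈ Metric.ball x₀ r, HasFDerivAt J' (Φ (z, J' z)) z ∧ J' z ∈ K := by
  obtain ⟨L, hL⟩ := hΦ.exists_lipschitzOnWith_of_isCompact hΩ
    ((isCompact_closedBall x₀ r).prod hK) ((convex_closedBall x₀ r).prod hKc) hsub
  have hlim : ∀ z, ∃ w, z ∈ Metric.ball x₀ r → w ∈ K ∧ Tendsto (fun i => J i z) l (𝓝 w) := by
    intro z
    by_cases hz : z ∈ Metric.ball x₀ r
    · obtain ⟨w, hwK, hw⟩ := hK.ultrafilter_le_nhds' (l.map fun i => J i z)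
        (by filter_upwards [hJ] with i hi using (hi z hz).2 : ∀ᶠ i in l, J i z ∈ K)
      exact ⟨w, fun _ => ⟨hwK, hw⟩⟩
    · exact ⟨0, fun h => absurd h hz⟩
  choose J' hJ' using hlim
  have hJ0 := (hJ' x₀ (Metric.mem_ball_self hr)).2
  -- The difference of two solutions is controlled by their difference at the center, so convergence
  -- there is enough for uniform convergence.
  have hunif : TendstoUniformlyOn J J' l (Metric.ball x₀ r) := by
    rw [Metric.tendstoUniformlyOn_iff]
    intro e he
    have h0 : Tendsto (fun i => ‖J i x₀ - J' x₀‖ * Real.exp (L * r)) l (𝓝 0) := by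
      simpa using ((hJ0.sub_const (J' x₀)).norm).mul_const (Real.exp (L * r))
    filter_upwards [h0.eventually_lt_const he, hJ] with i hi hi2 z hz
    rw [dist_comm, dist_eq_norm]
    refine lt_of_le_of_lt ?_ hi
    refine le_of_tendsto_of_tendsto (((hJ' z hz).2.const_sub (J i z)).norm)
      ((hJ0.const_sub (J i x₀)).norm.mul_const _) ?_
    filter_upwards [hJ] with j hj using norm_sub_le_of_totalDifferential hL hi2 hj hz
  refine ⟨J', hunif, fun z hz => ⟨?_, (hJ' z hz).1⟩⟩
  have hΦunif : TendstoUniformlyOn (fun i z => Φ (z, J i z)) (fun z => Φ (z, J' z)) l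
      (Metric.ball x₀ r) := by
    rw [Metric.tendstoUniformlyOn_iff] at hunif ⊢
    intro e he
    -- L + 1 in place of L avoids division by zero.
    filter_upwards [hunif (e / (L + 1)) (by positivity), hJ] with i hi hi2 z hz
    have hm := Metric.ball_subset_closedBall hz
    have h := hL.dist_le_mul (z, J' z) ⟨hm, (hJ' z hz).1⟩ (z, J i z) ⟨hm, (hi2 z hz).2⟩
    rw [Prod.dist_eq] at h
    simp only [dist_self, dist_nonneg, sup_of_le_right] at h
    have h2 := hi z hz
    rw [lt_div_iff₀ (by positivity)] at h2
    nlinarith [dist_nonneg (x := J' z) (y := J i z)]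
  have hnhds : Metric.ball x₀ r ∈ 𝓝 z := Metric.isOpen_ball.mem_nhds hz
  refine hasFDerivAt_of_tendstoUniformlyOnFilter (l := l)
    (f' := fun i z => Φ (z, J i z)) (g' := fun z => Φ (z, J' z)) ?_ ?_ ?_ (f := J)
  · exact hΦunif.tendstoUniformlyOnFilter.mono_right (le_principal_iff.2 hnhds)
  · filter_upwards [hJ.prod_mk (lb := 𝓝 z) hnhds] with p hp using (hp.1 p.2 hp.2).1
  · filter_upwards [hnhds] with y hy using (hJ' y hy).2

end TotalDifferentialEquation

/-! ### Christoffel symbols and the jet equation of isometries -/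

section LocalMetrics

set_option synthInstance.maxHeartbeats 100000
set_option maxSynthPendingDepth 3

variable {E : Type*} [NormedAddCommGroup E] [NormedSpace ℝ E]

/-- A smooth family of positive definite symmetric bilinear forms on an open set. -/
structure IsSmoothMetricOn (g : E → E →L[ℝ] E →L[ℝ] ℝ) (U : Set E) : Prop where
  isOpen : IsOpen U
  contDiffOn : ContDiffOn ℝ ∞ g U
  symm : ∀ x ∈ U, ∀ v w, g x v w = g x w v
  pos : ∀ x ∈ U, ∀ v, v ≠ 0 → 0 < g x v v

/-- The Koszul combination `(D(u, v, w) + D(v, u, w) - D(w, u, v)) / 2`. -/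
def koszul (D : E →L[ℝ] E →L[ℝ] E →L[ℝ] ℝ) : E →L[ℝ] E →L[ℝ] E →L[ℝ] ℝ :=
  (1 / 2 : ℝ) • (D + D.flip -
    ((ContinuousLinearMap.flipₗᵢ ℝ E E ℝ).toContinuousLinearEquiv :
      (E →L[ℝ] E →L[ℝ] ℝ) →L[ℝ] (E →L[ℝ] E →L[ℝ] ℝ)) ∘L D.flip)

lemma koszul_apply (D : E →L[ℝ] E →L[ℝ] E →L[ℝ] ℝ) (u v w : E) :
    koszul D u v w = (D u v w + D v u w - D w u v) / 2 := by
  simp [koszul]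
  ring

/-- The Christoffel symbols (of the second kind) of the metric `g`. -/
def christoffelSharp (g : E → E →L[ℝ] E →L[ℝ] ℝ) (x : E) : E →L[ℝ] E →L[ℝ] E :=
  (ContinuousLinearMap.compL ℝ E (E →L[ℝ] ℝ) E (g x).inverse) ∘L koszul (fderiv ℝ g x)

lemma christoffelSharp_apply (g : E → E →L[ℝ] E →L[ℝ] ℝ) (x u v : E) :
    christoffelSharp g x u v = (g x).inverse (koszul (fderiv ℝ g x) u v) := rfl

variable [FiniteDimensional ℝ E]

namespace IsSmoothMetricOn

variable {g g' : E → E →L[ℝ] E →L[ℝ] ℝ} {U U' : Set E}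

lemma exists_equiv (hg : IsSmoothMetricOn g U) {x : E} (hx : x ∈ U) :
    ∃ e : E ≃L[ℝ] (E →L[ℝ] ℝ), (e : E →L[ℝ] (E →L[ℝ] ℝ)) = g x := by
  have hinj : Function.Injective (g x : E →ₗ[ℝ] (E →L[ℝ] ℝ)) := by
    rw [← LinearMap.ker_eq_bot, LinearMap.ker_eq_bot']
    intro v hv
    by_contra hne
    have h := hg.pos x hx v hne
    have h0 : g x v = 0 := hv
    simp [h0] at h
  have hdim : Module.finrank ℝ E = Module.finrank ℝ (E →L[ℝ] ℝ) := by
    rw [← (LinearMap.toContinuousLinearMap : (E →ₗ[ℝ] ℝ) ≃ₗ[ℝ] (E →L[ℝ] ℝ)).finrank_eq]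
    exact (Subspace.dual_finrank_eq (K := ℝ) (V := E)).symm
  refine ⟨(LinearMap.linearEquivOfInjective _ hinj hdim).toContinuousLinearEquiv, ?_⟩
  ext v w
  rfl

lemma apply_christoffelSharp (hg : IsSmoothMetricOn g U) {x : E} (hx : x ∈ U) (u v w : E) :
    g x (christoffelSharp g x u v) w = koszul (fderiv ℝ g x) u v w := by
  obtain ⟨e, he⟩ := hg.exists_equiv hx
  rw [christoffelSharp_apply, ← he, ContinuousLinearMap.inverse_equiv]
  simp

lemma contDiffOn_christoffelSharp (hg : IsSmoothMetricOn g U) :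
    ContDiffOn ℝ ∞ (christoffelSharp g) U := by
  have hinv : ContDiffOn ℝ ∞ (fun x => (g x).inverse) U := by
    intro x hx
    obtain ⟨e, he⟩ := hg.exists_equiv hx
    have h := contDiffAt_map_inverse (𝕜 := ℝ) (n := ∞) e
    rw [he] at h
    exact h.comp_contDiffWithinAt x (hg.contDiffOn x hx)
  have hD : ContDiffOn ℝ ∞ (fderiv ℝ g) U :=
    hg.contDiffOn.fderiv_of_isOpen hg.isOpen (by simp)
  have hD' : ∀ u v w, ContDiffOn ℝ ∞ (fun x => fderiv ℝ g x u v w) U := fun u v w =>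
    ((hD.clm_apply contDiffOn_const).clm_apply contDiffOn_const).clm_apply contDiffOn_const
  refine contDiffOn_clm_apply.2 fun u => contDiffOn_clm_apply.2 fun v => ?_
  simp only [christoffelSharp_apply]
  refine hinv.clm_apply (contDiffOn_clm_apply.2 fun w => ?_)
  simp only [koszul_apply]
  exact (((hD' u v w).add (hD' v u w)).sub (hD' w u v)).div_const 2

omit [FiniteDimensional ℝ E] in
lemma eq_zero_of_forall_apply_eq_zero (hg : IsSmoothMetricOn g U) {x : E} (hx : x ∈ U) {v : E}
    (h : ∀ w, g x v w = 0) : v = 0 := by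
  by_contra hne
  exact (hg.pos x hx v hne).ne' (h v)

end IsSmoothMetricOn

/-- The differential of the one-jet of an isometry, as a function of the point and the jet. -/
def isometryJetField (g g' : E → E →L[ℝ] E →L[ℝ] ℝ) (p : E × (E × (E →L[ℝ] E))) :
    E →L[ℝ] (E × (E →L[ℝ] E)) :=
  p.2.2.prod ((ContinuousLinearMap.compL ℝ E E E p.2.2) ∘L (christoffelSharp g p.1) -
    ((ContinuousLinearMap.compL ℝ E E E).flip p.2.2) ∘L (christoffelSharp g' p.2.1) ∘L p.2.2)

omit [FiniteDimensional ℝ E] in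
lemma isometryJetField_apply_snd (g g' : E → E →L[ℝ] E →L[ℝ] ℝ) (z y : E) (F : E →L[ℝ] E)
    (u v : E) : (isometryJetField g g' (z, y, F) u).2 v =
      F (christoffelSharp g z u v) - christoffelSharp g' y (F u) (F v) := rfl

variable {g g' : E → E →L[ℝ] E →L[ℝ] ℝ} {U U' : Set E}

lemma contDiffOn_isometryJetField (hg : IsSmoothMetricOn g U) (hg' : IsSmoothMetricOn g' U') :
    ContDiffOn ℝ ∞ (isometryJetField g g') (U ×ˢ (U' ×ˢ univ)) := by
  have hF : ContDiffOn ℝ ∞ (fun p : E × (E × (E →L[ℝ] E)) => p.2.2) (U ×ˢ (U' ×ˢ univ)) :=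
    (contDiff_snd.comp contDiff_snd).contDiffOn
  have hFu : ∀ u, ContDiffOn ℝ ∞ (fun p : E × (E × (E →L[ℝ] E)) => p.2.2 u) (U ×ˢ (U' ×ˢ univ)) :=
    fun u => hF.clm_apply contDiffOn_const
  have h1 : ContDiffOn ℝ ∞ (fun p : E × (E × (E →L[ℝ] E)) => christoffelSharp g p.1)
      (U ×ˢ (U' ×ˢ univ)) :=
    hg.contDiffOn_christoffelSharp.comp contDiff_fst.contDiffOn fun p hp => hp.1
  have h2 : ContDiffOn ℝ ∞ (fun p : E × (E × (E →L[ℝ] E)) => christoffelSharp g' p.2.1)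
      (U ×ˢ (U' ×ˢ univ)) :=
    hg'.contDiffOn_christoffelSharp.comp (contDiff_fst.comp contDiff_snd).contDiffOn
      fun p hp => hp.2.1
  refine contDiffOn_clm_apply.2 fun u => ContDiffOn.prodMk (hFu u)
    (contDiffOn_clm_apply.2 fun v => ?_)
  exact (hF.clm_apply ((h1.clm_apply contDiffOn_const).clm_apply contDiffOn_const)).sub
    ((h2.clm_apply (hFu u)).clm_apply (hFu v))

/-- The one-jet of an isometry solves the total differential equation of `isometryJetField`. -/
lemma hasFDerivAt_jet_of_isometry (hg : IsSmoothMetricOn g U) (hg' : IsSmoothMetricOn g' U')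
    {f : E → E} {V : Set E} (hV : IsOpen V) (hVU : V ⊆ U) (hfV : MapsTo f V U')
    (hf : ContDiffOn ℝ ∞ f V)
    (hiso : ∀ x ∈ V, ∀ v w, g' (f x) (fderiv ℝ f x v) (fderiv ℝ f x w) = g x v w)
    {x : E} (hx : x ∈ V) :
    HasFDerivAt (fun z => (f z, fderiv ℝ f z)) (isometryJetField g g' (x, f x, fderiv ℝ f x)) x := by
  have hVx := hV.mem_nhds hx
  have hfx : HasFDerivAt f (fderiv ℝ f x) x :=
    ((hf.differentiableOn (by simp)).differentiableAt hVx).hasFDerivAt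
  have hF : HasFDerivAt (fderiv ℝ f) (fderiv ℝ (fderiv ℝ f) x) x :=
    (((hf.fderiv_of_isOpen (m := ∞) hV (by simp)).differentiableOn (by simp)).differentiableAt
      hVx).hasFDerivAt
  set F := fderiv ℝ f x with hFdef
  set S := fderiv ℝ (fderiv ℝ f) x
  have hsymm : ∀ u v, S u v = S v u := by
    have h : IsSymmSndFDerivAt ℝ f x := (hf.contDiffAt hVx).isSymmSndFDerivAt (by
      rw [minSmoothness_of_isRCLikeNormedField]; exact ENat.LEInfty.out)
    exact fun u v => h u v
  have hgx : HasFDerivAt g (fderiv ℝ g x) x :=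
    ((hg.contDiffOn.differentiableOn (by simp)).differentiableAt
      (hg.isOpen.mem_nhds (hVU hx))).hasFDerivAt
  have hgx' : HasFDerivAt g' (fderiv ℝ g' (f x)) (f x) :=
    ((hg'.contDiffOn.differentiableOn (by simp)).differentiableAt
      (hg'.isOpen.mem_nhds (hfV hx))).hasFDerivAt
  -- This is the derivative in direction u of the isometry identity g'(F v, F w) = g(v, w).
  have hdiff : ∀ u v w, fderiv ℝ g' (f x) (F u) (F v) (F w) + g' (f x) (S u v) (F w)
      + g' (f x) (F v) (S u w) = fderiv ℝ g x u v w := by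
    intro u v w
    have hFv : ∀ v, HasFDerivAt (fun z => fderiv ℝ f z v) (S.flip v) x := fun v => by
      have := hF.clm_apply (hasFDerivAt_const v x)
      convert this using 1
      ext; simp
    have hc : HasFDerivAt (fun z => g' (f z)) ((fderiv ℝ g' (f x)).comp F) x := hgx'.comp x hfx
    have h1 := (hc.clm_apply (hFv v)).clm_apply (hFv w)
    have h2 := (hgx.clm_apply (hasFDerivAt_const v x)).clm_apply (hasFDerivAt_const w x)
    have h3 := h1.congr_of_eventuallyEq
      (f₁ := fun z => g z v w) (by filter_upwards [hVx] with z hz using (hiso z hz v w).symm)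
    have h4 := congrArg (fun T => T u) (h3.unique h2)
    simp at h4
    rw [← h4]
    ring
  have hinj : Function.Injective F := by
    rw [injective_iff_map_eq_zero]
    intro v hv
    refine hg.eq_zero_of_forall_apply_eq_zero (hVU hx) fun w => ?_
    rw [← hiso x hx, ← hFdef, hv]; simp
  have hsurj : Function.Surjective F :=
    (LinearMap.injective_iff_surjective (f := (F : E →ₗ[ℝ] E))).1 hinj
  -- The Koszul combination of three instances of `hdiff` isolates g'(S u v, F w), by symmetry of S
  -- and g'. Since F is surjective, the vectors F w suffice for testing.
  have hS : ∀ u v, S u v = F (christoffelSharp g x u v) - christoffelSharp g' (f x) (F u) (F v) := by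
    intro u v
    rw [← sub_eq_zero]
    refine hg'.eq_zero_of_forall_apply_eq_zero (hfV hx) fun w' => ?_
    obtain ⟨w, rfl⟩ := hsurj w'
    have e1 : g' (f x) (F (christoffelSharp g x u v)) (F w) = koszul (fderiv ℝ g x) u v w := by
      rw [hFdef, hiso x hx, hg.apply_christoffelSharp (hVU hx)]
    have e2 := hg'.apply_christoffelSharp (hfV hx) (F u) (F v) (F w)
    simp only [map_sub, sub_apply, e1, e2, koszul_apply]
    have a1 := hdiff u v w
    have a2 := hdiff v u w
    have a3 := hdiff w u v
    have b := hg'.symm (f x) (hfV hx)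
    rw [hsymm v u] at a2
    rw [hsymm w u, hsymm w v] at a3
    rw [b (F v)] at a1
    rw [b (F u)] at a2 a3
    linarith
  have h := hfx.prodMk hF
  convert h using 1
  ext u : 1
  refine Prod.ext rfl ?_
  ext v
  rw [isometryJetField_apply_snd, ← hS]
  rfl

end LocalMetrics

/-! ### The Riemannian metric in a chart -/

section ChartMetrics

set_option synthInstance.maxHeartbeats 100000

variable {n : ℕ} {M : Type*} [TopologicalSpace M]
  [ChartedSpace (EuclideanSpace ℝ (Fin n)) M] [IsManifold (𝓡 n) ∞ M]
  [RiemannianBundle (fun x : M => TangentSpace (𝓡 n) x)]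

local notation "𝔼" => EuclideanSpace ℝ (Fin n)

/-- The Riemannian metric read in the chart at `x₀`, as a bilinear form. -/
def metricInChart (x₀ : M) (z : 𝔼) : 𝔼 →L[ℝ] 𝔼 →L[ℝ] ℝ :=
  let D : 𝔼 →L[ℝ] TangentSpace (𝓡 n) ((extChartAt (𝓡 n) x₀).symm z) :=
    mfderiv (𝓡 n) (𝓡 n) (extChartAt (𝓡 n) x₀).symm z
  (innerSL ℝ (E := TangentSpace (𝓡 n) ((extChartAt (𝓡 n) x₀).symm z))).bilinearComp D D

omit [IsManifold (𝓡 n) ∞ M] in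
lemma metricInChart_apply (x₀ : M) (z v w : 𝔼) :
    metricInChart x₀ z v w = ⟪mfderiv (𝓡 n) (𝓡 n) (extChartAt (𝓡 n) x₀).symm z v,
      mfderiv (𝓡 n) (𝓡 n) (extChartAt (𝓡 n) x₀).symm z w⟫_ℝ := rfl

variable [IsContMDiffRiemannianBundle (𝓡 n) ∞ (EuclideanSpace ℝ (Fin n))
      (fun x : M => TangentSpace (𝓡 n) x)]

/-- Smoothness reduces to constant v and w, whose images under the differential of the inverse chart
are smooth maps into the tangent bundle, paired by a smooth bundle metric. Positivity holds because
that differential is invertible. -/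
lemma isSmoothMetricOn_metricInChart (x₀ : M) :
    IsSmoothMetricOn (metricInChart (n := n) x₀) (extChartAt (𝓡 n) x₀).target := by
  have hopen : IsOpen (extChartAt (𝓡 n) x₀).target := isOpen_extChartAt_target x₀
  refine ⟨hopen, ?_, ?_, ?_⟩
  · have hsec : ∀ v : 𝔼, ContMDiffOn (𝓡 n) ((𝓡 n).prod 𝓘(ℝ, 𝔼)) ∞
        (fun z : 𝔼 => (⟨(extChartAt (𝓡 n) x₀).symm z,
          mfderiv (𝓡 n) (𝓡 n) (extChartAt (𝓡 n) x₀).symm z v⟩ : TangentBundle (𝓡 n) M))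
        (extChartAt (𝓡 n) x₀).target := by
      intro v
      have h1 := (contMDiffOn_extChartAt_symm (I := 𝓡 n) (n := ∞) x₀).contMDiffOn_tangentMapWithin
        (m := ∞) le_rfl hopen.uniqueMDiffOn
      have h2 : ContMDiff (𝓡 n) (𝓡 n).tangent ∞ (fun z : 𝔼 => (⟨z, v⟩ : TangentBundle (𝓡 n) 𝔼)) :=
        contMDiff_vectorSpace_iff_contDiff.2 contDiff_const
      have h3 := h1.comp (h2.contMDiffOn (s := (extChartAt (𝓡 n) x₀).target)) (fun z hz => hz)
      refine h3.congr fun z hz => ?_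
      simp only [Function.comp_apply, tangentMapWithin]
      rw [mfderivWithin_of_isOpen hopen hz]
    refine contDiffOn_clm_apply.2 fun v => contDiffOn_clm_apply.2 fun w => ?_
    rw [← contMDiffOn_iff_contDiffOn]
    exact (hsec v).inner_bundle (hsec w)
  · intro z _ v w
    simp only [metricInChart_apply]
    exact real_inner_comm _ _
  · intro z hz v hv
    rw [metricInChart_apply]
    refine real_inner_self_pos.2 fun h0 => hv ?_
    have h := isInvertible_mfderivWithin_extChartAt_symm (I := 𝓡 n) hz
    rw [ModelWithCorners.range_eq_univ, mfderivWithin_univ] at h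
    obtain ⟨e, he⟩ := h
    rw [← he] at h0
    exact e.map_eq_zero_iff.1 h0

end ChartMetrics

/-! ### Maps and isometries in coordinates -/

section CoordinateRepresentation

set_option synthInstance.maxHeartbeats 100000

variable {n : ℕ} {M : Type*} [TopologicalSpace M]
  [ChartedSpace (EuclideanSpace ℝ (Fin n)) M]

local notation "𝔼" => EuclideanSpace ℝ (Fin n)

/-- A map `φ : M → M` read in the charts at `x₀` and `y₀`. -/
def coordRep (x₀ y₀ : M) (φ : M → M) (z : 𝔼) : 𝔼 :=
  extChartAt (𝓡 n) y₀ (φ ((extChartAt (𝓡 n) x₀).symm z))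

/-- The domain on which `coordRep x₀ y₀ φ` is meaningful. -/
def coordDomain (x₀ y₀ : M) (φ : M → M) : Set 𝔼 :=
  (extChartAt (𝓡 n) x₀).target ∩
    {z | φ ((extChartAt (𝓡 n) x₀).symm z) ∈ (extChartAt (𝓡 n) y₀).source}

lemma isOpen_coordDomain (x₀ y₀ : M) {φ : M → M} (hφ : Continuous φ) :
    IsOpen (coordDomain (n := n) x₀ y₀ φ) :=
  (hφ.comp_continuousOn (continuousOn_extChartAt_symm x₀)).isOpen_inter_preimage
    (isOpen_extChartAt_target x₀) (isOpen_extChartAt_source y₀)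

lemma coordRep_mapsTo (x₀ y₀ : M) (φ : M → M) :
    MapsTo (coordRep (n := n) x₀ y₀ φ) (coordDomain x₀ y₀ φ) (extChartAt (𝓡 n) y₀).target :=
  fun _ hz => (extChartAt (𝓡 n) y₀).map_source hz.2

lemma extChartAt_mem_coordDomain {x₀ y₀ x : M} {φ : M → M}
    (hx : x ∈ (extChartAt (𝓡 n) x₀).source) (hy : φ x ∈ (extChartAt (𝓡 n) y₀).source) :
    extChartAt (𝓡 n) x₀ x ∈ coordDomain (n := n) x₀ y₀ φ :=
  ⟨(extChartAt (𝓡 n) x₀).map_source hx, by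
    simpa only [mem_ofPred_eq, (extChartAt (𝓡 n) x₀).left_inv hx] using hy⟩

variable [IsManifold (𝓡 n) ∞ M]

lemma contDiffOn_coordRep (x₀ y₀ : M) {φ : M → M} (hφ : ContMDiff (𝓡 n) (𝓡 n) ∞ φ) :
    ContDiffOn ℝ ∞ (coordRep (n := n) x₀ y₀ φ) (coordDomain x₀ y₀ φ) := by
  rw [← contMDiffOn_iff_contDiffOn]
  have h1 : ContMDiffOn (𝓡 n) (𝓡 n) ∞ (extChartAt (𝓡 n) y₀) (extChartAt (𝓡 n) y₀).source := by
    rw [extChartAt_source]; exact contMDiffOn_extChartAt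
  exact h1.comp (hφ.comp_contMDiffOn ((contMDiffOn_extChartAt_symm x₀).mono inter_subset_left))
    fun z hz => hz.2

variable [RiemannianBundle (fun x : M => TangentSpace (𝓡 n) x)]

-- The two inner products live in the fibres over h z and h' z, which are equal points but not
-- definitionally so. Generalizing the base point before substituting avoids transport between the
-- fibres.
omit [IsManifold (𝓡 n) ∞ M] in
lemma inner_mfderiv_congr {N : Type*} [TopologicalSpace N]
    [ChartedSpace (EuclideanSpace ℝ (Fin n)) N] {h h' : N → M} {z : N} (heq : h =ᶠ[𝓝 z] h')
    (v w : TangentSpace (𝓡 n) z) :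
    ⟪mfderiv (𝓡 n) (𝓡 n) h z v, mfderiv (𝓡 n) (𝓡 n) h z w⟫_ℝ =
      ⟪mfderiv (𝓡 n) (𝓡 n) h' z v, mfderiv (𝓡 n) (𝓡 n) h' z w⟫_ℝ := by
  have key : ∀ (a b : M) (_ : a = b) (v w : 𝔼),
      ⟪(show TangentSpace (𝓡 n) a from v), (show TangentSpace (𝓡 n) a from w)⟫_ℝ =
      ⟪(show TangentSpace (𝓡 n) b from v), (show TangentSpace (𝓡 n) b from w)⟫_ℝ := by
    rintro a _ rfl v w
    rfl
  have e2 : (mfderiv (𝓡 n) (𝓡 n) h z : 𝔼 →L[ℝ] 𝔼) = mfderiv (𝓡 n) (𝓡 n) h' z := heq.mfderiv_eq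
  refine (key (h z) (h' z) heq.self_of_nhds _ _).trans ?_
  congr 1
  · exact congrArg (fun T : 𝔼 →L[ℝ] 𝔼 => T v) e2
  · exact congrArg (fun T : 𝔼 →L[ℝ] 𝔼 => T w) e2

omit [RiemannianBundle (fun x : M => TangentSpace (𝓡 n) x)] in
lemma mdifferentiableAt_extChartAt_symm (x₀ : M) {z : 𝔼} (hz : z ∈ (extChartAt (𝓡 n) x₀).target) :
    MDifferentiableAt (𝓡 n) (𝓡 n) (extChartAt (𝓡 n) x₀).symm z :=
  (((contMDiffOn_extChartAt_symm (n := ∞) x₀).contMDiffAt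
    ((isOpen_extChartAt_target x₀).mem_nhds hz)).mdifferentiableAt (by simp))

omit [RiemannianBundle (fun x : M => TangentSpace (𝓡 n) x)] in
lemma mdifferentiableAt_extChartAt_of_mem (x₀ : M) {x : M}
    (hx : x ∈ (extChartAt (𝓡 n) x₀).source) :
    MDifferentiableAt (𝓡 n) (𝓡 n) (extChartAt (𝓡 n) x₀) x := by
  rw [extChartAt_source] at hx
  exact (contMDiffAt_extChartAt' (n := ∞) hx).mdifferentiableAt (by simp)

/-- In coordinates, a map pulls the metric back to the form given by its differential. -/
lemma metricInChart_coordRep (x₀ y₀ : M) {φ : M → M} {z : 𝔼} (f : 𝔼 → 𝔼)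
    (hz : z ∈ (extChartAt (𝓡 n) x₀).target) (hf : DifferentiableAt ℝ f z)
    (hfz : f z ∈ (extChartAt (𝓡 n) y₀).target)
    (hφ : MDifferentiableAt (𝓡 n) (𝓡 n) φ ((extChartAt (𝓡 n) x₀).symm z))
    (heq : (extChartAt (𝓡 n) y₀).symm ∘ f =ᶠ[𝓝 z] φ ∘ (extChartAt (𝓡 n) x₀).symm) (v w : 𝔼) :
    metricInChart y₀ (f z) (fderiv ℝ f z v) (fderiv ℝ f z w) =
      ⟪mfderiv (𝓡 n) (𝓡 n) φ ((extChartAt (𝓡 n) x₀).symm z)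
          (mfderiv (𝓡 n) (𝓡 n) (extChartAt (𝓡 n) x₀).symm z v),
        mfderiv (𝓡 n) (𝓡 n) φ ((extChartAt (𝓡 n) x₀).symm z)
          (mfderiv (𝓡 n) (𝓡 n) (extChartAt (𝓡 n) x₀).symm z w)⟫_ℝ := by
  have h1 := inner_mfderiv_congr heq v w
  rw [mfderiv_comp z (mdifferentiableAt_extChartAt_symm y₀ hfz) hf.mdifferentiableAt,
    mfderiv_comp z hφ (mdifferentiableAt_extChartAt_symm x₀ hz), mfderiv_eq_fderiv] at h1
  rw [metricInChart_apply]
  exact h1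

lemma metricInChart_coordRep_of_isometry (x₀ y₀ : M) {φ : M → M}
    (hφ : ContMDiff (𝓡 n) (𝓡 n) ∞ φ)
    (hiso : ∀ (x : M) (v w : TangentSpace (𝓡 n) x),
      ⟪mfderiv (𝓡 n) (𝓡 n) φ x v, mfderiv (𝓡 n) (𝓡 n) φ x w⟫_ℝ = ⟪v, w⟫_ℝ)
    {z : 𝔼} (hz : z ∈ coordDomain (n := n) x₀ y₀ φ) (v w : 𝔼) :
    metricInChart y₀ (coordRep x₀ y₀ φ z) (fderiv ℝ (coordRep x₀ y₀ φ) z v)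
      (fderiv ℝ (coordRep x₀ y₀ φ) z w) = metricInChart x₀ z v w := by
  have hV := (isOpen_coordDomain x₀ y₀ hφ.continuous).mem_nhds hz
  rw [metricInChart_coordRep x₀ y₀ (φ := φ) _ hz.1
    (((contDiffOn_coordRep x₀ y₀ hφ).contDiffAt hV).differentiableAt (by simp))
    (coordRep_mapsTo x₀ y₀ φ hz) (hφ.mdifferentiable (by simp) _)
    (by filter_upwards [hV] with z' hz' using (extChartAt (𝓡 n) y₀).left_inv hz'.2), hiso,
    metricInChart_apply]

/-- A map is smooth and isometric at a point if it is so in coordinates. -/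
lemma isometry_at_of_coordinates {x₀ y₀ x : M} {φ : M → M} {f : 𝔼 → 𝔼}
    (hx : x ∈ (extChartAt (𝓡 n) x₀).source)
    (hf : ContDiffAt ℝ ∞ f (extChartAt (𝓡 n) x₀ x))
    (hfy : f (extChartAt (𝓡 n) x₀ x) ∈ (extChartAt (𝓡 n) y₀).target)
    (heq : φ ∘ (extChartAt (𝓡 n) x₀).symm =ᶠ[𝓝 (extChartAt (𝓡 n) x₀ x)]
      (extChartAt (𝓡 n) y₀).symm ∘ f)
    (hiso : ∀ v w, metricInChart y₀ (f (extChartAt (𝓡 n) x₀ x))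
      (fderiv ℝ f (extChartAt (𝓡 n) x₀ x) v) (fderiv ℝ f (extChartAt (𝓡 n) x₀ x) w) =
      metricInChart x₀ (extChartAt (𝓡 n) x₀ x) v w) :
    ContMDiffAt (𝓡 n) (𝓡 n) ∞ φ x ∧ ∀ v w : TangentSpace (𝓡 n) x,
      ⟪mfderiv (𝓡 n) (𝓡 n) φ x v, mfderiv (𝓡 n) (𝓡 n) φ x w⟫_ℝ = ⟪v, w⟫_ℝ := by
  have hx' := hx
  rw [extChartAt_source] at hx'
  have hsrc : (extChartAt (𝓡 n) x₀).source ∈ 𝓝 x := (isOpen_extChartAt_source x₀).mem_nhds hx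
  have hcont : ContinuousAt (extChartAt (𝓡 n) x₀) x := continuousAt_extChartAt' hx
  have heq' : φ =ᶠ[𝓝 x] ((extChartAt (𝓡 n) y₀).symm ∘ f) ∘ extChartAt (𝓡 n) x₀ := by
    filter_upwards [hcont.eventually heq, hsrc] with y hy hys
    simp only [Function.comp_apply] at hy ⊢
    rw [← hy, (extChartAt (𝓡 n) x₀).left_inv hys]
  have hsymm : ContMDiffAt (𝓡 n) (𝓡 n) ∞ (extChartAt (𝓡 n) y₀).symm (f (extChartAt (𝓡 n) x₀ x)) :=
    (contMDiffOn_extChartAt_symm (n := ∞) y₀).contMDiffAt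
      ((isOpen_extChartAt_target y₀).mem_nhds hfy)
  have h1 : ContMDiffAt (𝓡 n) (𝓡 n) ∞ ((extChartAt (𝓡 n) y₀).symm ∘ f) (extChartAt (𝓡 n) x₀ x) :=
    hsymm.comp _ hf.contMDiffAt
  have h2 : ContMDiffAt (𝓡 n) (𝓡 n) ∞ (((extChartAt (𝓡 n) y₀).symm ∘ f) ∘ extChartAt (𝓡 n) x₀) x :=
    h1.comp x (contMDiffAt_extChartAt' hx')
  refine ⟨h2.congr_of_eventuallyEq heq', fun v w => ?_⟩
  rw [inner_mfderiv_congr heq' v w, mfderiv_comp x (h1.mdifferentiableAt (by simp))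
    (mdifferentiableAt_extChartAt_of_mem x₀ hx), mfderiv_comp _ (hsymm.mdifferentiableAt (by simp))
    (hf.differentiableAt (by simp)).mdifferentiableAt, mfderiv_eq_fderiv]
  refine (hiso _ _).trans ?_
  -- Differentiating this identity converts the coordinate metric on chart images of v and w back to
  -- the inner product at x.
  have h3 : (extChartAt (𝓡 n) x₀).symm ∘ extChartAt (𝓡 n) x₀ =ᶠ[𝓝 x] id := by
    filter_upwards [hsrc] with y hys using (extChartAt (𝓡 n) x₀).left_inv hys
  have h4 := inner_mfderiv_congr h3 v w
  rw [mfderiv_comp x (mdifferentiableAt_extChartAt_symm x₀ ((extChartAt (𝓡 n) x₀).map_source hx))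
    (mdifferentiableAt_extChartAt_of_mem x₀ hx), mfderiv_id] at h4
  exact h4

end CoordinateRepresentation

/-! ### Isometries preserve the Riemannian distance -/

section Distance

variable {n : ℕ} {M : Type*} [EMetricSpace M]
  [ChartedSpace (EuclideanSpace ℝ (Fin n)) M]
  [RiemannianBundle (fun x : M => TangentSpace (𝓡 n) x)] [IsRiemannianManifold (𝓡 n) M]

/-- The distance is an infimum of lengths of C¹ paths, and composing a path with a preserves its
speed, hence its length. -/
lemma Isom.edist_smul_le (a : Isom n M) (x y : M) : edist (a • x) (a • y) ≤ edist x y := by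
  obtain ⟨hφ, -, hiso⟩ := a.2
  rw [IsRiemannianManifold.out (I := 𝓡 n) x y]
  refine le_of_forall_gt fun r hr => ?_
  obtain ⟨γ, h0, h1, hγ, hlen⟩ := Manifold.exists_lt_of_riemannianEDist_lt hr
  refine lt_of_le_of_lt ?_ hlen
  rw [IsRiemannianManifold.out (I := 𝓡 n)]
  have hc : ContMDiffOn 𝓘(ℝ, ℝ) (𝓡 n) 1 (fun t => a • γ t) (Icc 0 1) :=
    (hφ.of_le (by simp)).comp_contMDiffOn hγ
  refine (Manifold.riemannianEDist_le_pathELength hc (by rw [h0]) (by rw [h1]) zero_le_one).trans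
    (le_of_eq ?_)
  rw [Manifold.pathELength_eq_lintegral_mfderiv_Ioo, Manifold.pathELength_eq_lintegral_mfderiv_Ioo]
  refine MeasureTheory.setLIntegral_congr_fun measurableSet_Ioo fun t ht => ?_
  have hd : MDifferentiableAt 𝓘(ℝ, ℝ) (𝓡 n) γ t :=
    (hγ.contMDiffAt (Icc_mem_nhds ht.1 ht.2)).mdifferentiableAt (by simp)
  have e : mfderiv 𝓘(ℝ, ℝ) (𝓡 n) (fun t => a • γ t) t =
      (mfderiv (𝓡 n) (𝓡 n) a.1 (γ t)).comp (mfderiv 𝓘(ℝ, ℝ) (𝓡 n) γ t) :=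
    mfderiv_comp t (hφ.mdifferentiable (by simp) _) hd
  have hn : ‖mfderiv 𝓘(ℝ, ℝ) (𝓡 n) (fun t => a • γ t) t (1 : ℝ)‖ =
      ‖mfderiv 𝓘(ℝ, ℝ) (𝓡 n) γ t (1 : ℝ)‖ := by
    rw [e, norm_eq_sqrt_real_inner, norm_eq_sqrt_real_inner]
    exact congrArg Real.sqrt (hiso (γ t) _ _)
  rw [← ofReal_norm, ← ofReal_norm]
  exact congrArg ENNReal.ofReal hn

lemma Isom.edist_smul (a : Isom n M) (x y : M) : edist (a • x) (a • y) = edist x y := by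
  refine le_antisymm (a.edist_smul_le x y) ?_
  simpa using a⁻¹.edist_smul_le (a • x) (a • y)

end Distance

/-! ### Local bounds on metrics and on differentials of isometries -/

section MetricBounds

set_option synthInstance.maxHeartbeats 100000
set_option maxSynthPendingDepth 3

variable {E : Type*} [NormedAddCommGroup E] [NormedSpace ℝ E] [FiniteDimensional ℝ E]
  {g g' : E → E →L[ℝ] E →L[ℝ] ℝ} {U U' : Set E}

/-- At x itself the constant comes from compactness of the unit sphere; half of it is given up to
absorb the variation of g near x. -/
lemma IsSmoothMetricOn.exists_lower_bound (hg : IsSmoothMetricOn g U) {x : E} (hx : x ∈ U) :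
    ∃ c > 0, ∀ᶠ z in 𝓝 x, ∀ v, c * ‖v‖ ^ 2 ≤ g z v v := by
  have : ProperSpace E := FiniteDimensional.proper_real E
  obtain ⟨c, hc, hcb⟩ := (isCompact_sphere (0 : E) 1).exists_forall_le' (f := fun v => g x v v)
    (a := 0) (by fun_prop) (fun v hv => hg.pos x hx v (by
      rintro rfl
      simp at hv))
  have hcv : ∀ v, c * ‖v‖ ^ 2 ≤ g x v v := by
    intro v
    by_cases hv : v = 0
    · simp [hv]
    · have hn : ‖v‖ ≠ 0 := norm_ne_zero_iff.2 hv
      have h := hcb (‖v‖⁻¹ • v) (by simp [norm_smul, hn])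
      simp only [map_smul, smul_apply, smul_eq_mul] at h
      calc c * ‖v‖ ^ 2 ≤ ‖v‖⁻¹ * (‖v‖⁻¹ * g x v v) * ‖v‖ ^ 2 := by gcongr
        _ = g x v v := by field_simp
  refine ⟨c / 2, by positivity, ?_⟩
  have hcont : ContinuousAt g x :=
    (hg.contDiffOn.contDiffAt (hg.isOpen.mem_nhds hx)).continuousAt
  have h0 : Tendsto (fun z => ‖g z - g x‖) (𝓝 x) (𝓝 0) := by
    simpa using (hcont.tendsto.sub_const (g x)).norm
  filter_upwards [h0.eventually_lt_const (half_pos hc)] with z hz v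
  have h1 : ‖(g z - g x) v v‖ ≤ c / 2 * ‖v‖ ^ 2 := by
    calc _ ≤ ‖g z - g x‖ * ‖v‖ * ‖v‖ := (g z - g x).le_opNorm₂ v v
      _ ≤ c / 2 * ‖v‖ * ‖v‖ := by gcongr
      _ = _ := by ring
  have h2 := (abs_le.1 h1).1
  simp only [sub_apply] at h2
  linarith [hcv v]

/-- Differentials of isometries between smooth metrics are locally uniformly bounded. -/
lemma IsSmoothMetricOn.exists_norm_le_of_isometry (hg : IsSmoothMetricOn g U)
    (hg' : IsSmoothMetricOn g' U') {x y : E} (hx : x ∈ U) (hy : y ∈ U') :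
    ∃ C, ∀ᶠ p in 𝓝 (x, y), ∀ F : E →L[ℝ] E,
      (∀ v, g' p.2 (F v) (F v) = g p.1 v v) → ‖F‖ ≤ C := by
  obtain ⟨c, hc, hlow⟩ := hg'.exists_lower_bound hy
  have hcont : ContinuousAt g x :=
    (hg.contDiffOn.contDiffAt (hg.isOpen.mem_nhds hx)).continuousAt
  set b := ‖g x‖ + 1 with hb
  have hbpos : 0 < b := by positivity
  -- From c‖F v‖² ≤ g'(F v, F v) = g(v, v) ≤ b‖v‖².
  refine ⟨Real.sqrt (b / c), ?_⟩
  rw [nhds_prod_eq]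
  filter_upwards [(hcont.norm.eventually_lt_const (lt_add_one ‖g x‖)).prod_mk hlow]
  rintro ⟨z, w⟩ ⟨hz, hw⟩ F hF
  refine F.opNorm_le_bound (Real.sqrt_nonneg _) fun v => ?_
  have h1 : g z v v ≤ b * ‖v‖ ^ 2 := by
    calc g z v v ≤ ‖g z v v‖ := le_abs_self _
      _ ≤ ‖g z‖ * ‖v‖ * ‖v‖ := (g z).le_opNorm₂ v v
      _ ≤ b * ‖v‖ * ‖v‖ := by gcongr
      _ = _ := by ring
  have h2 := (hw (F v)).trans ((hF v).le.trans h1)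
  rw [← Real.sqrt_sq (norm_nonneg v), ← Real.sqrt_mul (by positivity)]
  apply Real.le_sqrt_of_sq_le
  rw [div_mul_eq_mul_div, le_div_iff₀ hc]
  linarith

end MetricBounds

/-! ### Uniform control of the 1-jets of isometries -/

section UniformJets

set_option synthInstance.maxHeartbeats 100000

variable {n : ℕ} {M : Type*} [EMetricSpace M]
  [ChartedSpace (EuclideanSpace ℝ (Fin n)) M] [IsManifold (𝓡 n) ∞ M]
  [RiemannianBundle (fun x : M => TangentSpace (𝓡 n) x)]
  [IsContMDiffRiemannianBundle (𝓡 n) ∞ (EuclideanSpace ℝ (Fin n))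
      (fun x : M => TangentSpace (𝓡 n) x)]
  [IsRiemannianManifold (𝓡 n) M]

local notation "𝔼" => EuclideanSpace ℝ (Fin n)

/-- The one-jet of a map in coordinates. -/
def coordJet (x₀ y₀ : M) (φ : M → M) (z : 𝔼) : 𝔼 × (𝔼 →L[ℝ] 𝔼) :=
  (coordRep x₀ y₀ φ z, fderiv ℝ (coordRep x₀ y₀ φ) z)

/-- The one-jets of all isometries that move `x` close to `y` solve the same total differential
equation on a common ball, with values in a common compact convex set. -/
lemma exists_uniform_coordJet {x₀ y₀ x y : M} (hx : x ∈ (extChartAt (𝓡 n) x₀).source)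
    (hy : y ∈ (extChartAt (𝓡 n) y₀).source) :
    ∃ r > 0, ∃ K : Set (𝔼 × (𝔼 →L[ℝ] 𝔼)), IsCompact K ∧ Convex ℝ K ∧
      Metric.closedBall (extChartAt (𝓡 n) x₀ x) r ×ˢ K ⊆
        (extChartAt (𝓡 n) x₀).target ×ˢ ((extChartAt (𝓡 n) y₀).target ×ˢ univ) ∧
      ∃ δ > 0,
        (∀ φ : M → M, (∀ p q, edist (φ p) (φ q) = edist p q) → edist (φ x) y < δ →
          ∀ z ∈ Metric.ball (extChartAt (𝓡 n) x₀ x) r, z ∈ coordDomain (n := n) x₀ y₀ φ) ∧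
        ∀ a : Isom n M, edist (a • x) y < δ → ∀ z ∈ Metric.ball (extChartAt (𝓡 n) x₀ x) r,
          HasFDerivAt (coordJet x₀ y₀ (a • ·))
            (isometryJetField (metricInChart x₀) (metricInChart y₀)
              (z, coordJet x₀ y₀ (a • ·) z)) z ∧
          coordJet x₀ y₀ (a • ·) z ∈ K := by
  set z₀ := extChartAt (𝓡 n) x₀ x with hz₀
  set w₀ := extChartAt (𝓡 n) y₀ y with hw₀
  have hz₀t : z₀ ∈ (extChartAt (𝓡 n) x₀).target := (extChartAt (𝓡 n) x₀).map_source hx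
  have hw₀t : w₀ ∈ (extChartAt (𝓡 n) y₀).target := (extChartAt (𝓡 n) y₀).map_source hy
  have hg := isSmoothMetricOn_metricInChart (n := n) x₀
  have hg' := isSmoothMetricOn_metricInChart (n := n) y₀
  obtain ⟨C, hC⟩ := hg.exists_norm_le_of_isometry hg' hz₀t hw₀t
  obtain ⟨e, he, hC⟩ := Metric.eventually_nhds_iff.1 hC
  obtain ⟨ρ₁, hρ₁, hρ₁t⟩ := Metric.nhds_basis_closedBall.mem_iff.1 (hg'.isOpen.mem_nhds hw₀t)
  obtain ⟨r₁, hr₁, hr₁t⟩ := Metric.nhds_basis_closedBall.mem_iff.1 (hg.isOpen.mem_nhds hz₀t)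
  -- The bounds by e / 2, here and in r below, keep a point and its image within the radius e where
  -- the bound C on differentials holds.
  set ρ := min ρ₁ (e / 2) with hρ
  have hρpos : 0 < ρ := lt_min hρ₁ (half_pos he)
  have hN : (extChartAt (𝓡 n) y₀).source ∩ extChartAt (𝓡 n) y₀ ⁻¹' Metric.closedBall w₀ ρ ∈ 𝓝 y :=
    inter_mem ((isOpen_extChartAt_source y₀).mem_nhds hy)
      ((continuousAt_extChartAt' hy).preimage_mem_nhds (Metric.closedBall_mem_nhds w₀ hρpos))
  obtain ⟨ε, hε, hεN⟩ := EMetric.mem_nhds_iff.1 hN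
  have hsymm : Tendsto (extChartAt (𝓡 n) x₀).symm (𝓝 z₀) (𝓝 x) := by
    have h := continuousAt_extChartAt_symm'' (I := 𝓡 n) hz₀t
    rwa [ContinuousAt, hz₀, (extChartAt (𝓡 n) x₀).left_inv hx] at h
  have hδ : 0 < ε / 2 := ENNReal.half_pos hε.ne'
  obtain ⟨r₂, hr₂, hr₂s⟩ := Metric.eventually_nhds_iff.1
    (hsymm.eventually (Metric.eball_mem_nhds x hδ))
  set r := min (min r₁ r₂) (e / 2) with hr
  have hrpos : 0 < r := lt_min (lt_min hr₁ hr₂) (half_pos he)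
  have hsubt : Metric.closedBall z₀ r ⊆ (extChartAt (𝓡 n) x₀).target :=
    (Metric.closedBall_subset_closedBall ((min_le_left _ _).trans (min_le_left _ _))).trans hr₁t
  have hρt : Metric.closedBall w₀ ρ ⊆ (extChartAt (𝓡 n) y₀).target :=
    (Metric.closedBall_subset_closedBall (min_le_left _ _)).trans hρ₁t
  -- Since φ preserves distances, how far it spreads the ball does not depend on φ. One half of ε is
  -- for that spread, the other for the distance from φ x to y.
  have hclose : ∀ φ : M → M, (∀ p q, edist (φ p) (φ q) = edist p q) → edist (φ x) y < ε / 2 →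
      ∀ z ∈ Metric.ball z₀ r, φ ((extChartAt (𝓡 n) x₀).symm z) ∈
        (extChartAt (𝓡 n) y₀).source ∩ extChartAt (𝓡 n) y₀ ⁻¹' Metric.closedBall w₀ ρ := by
    intro φ hφ hφx z hz
    refine hεN ?_
    have h1 : edist ((extChartAt (𝓡 n) x₀).symm z) x < ε / 2 :=
      hr₂s (lt_of_lt_of_le hz ((min_le_left _ _).trans (min_le_right _ _)))
    calc edist (φ ((extChartAt (𝓡 n) x₀).symm z)) y
        ≤ edist (φ ((extChartAt (𝓡 n) x₀).symm z)) (φ x) + edist (φ x) y := edist_triangle _ _ _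
      _ < ε / 2 + ε / 2 := ENNReal.add_lt_add (by rwa [hφ]) hφx
      _ = ε := ENNReal.add_halves ε
  have hdom : ∀ φ : M → M, (∀ p q, edist (φ p) (φ q) = edist p q) → edist (φ x) y < ε / 2 →
      ∀ z ∈ Metric.ball z₀ r, z ∈ coordDomain (n := n) x₀ y₀ φ := fun φ hφ hφx z hz =>
    ⟨hsubt (Metric.ball_subset_closedBall hz), (hclose φ hφ hφx z hz).1⟩
  refine ⟨r, hrpos, Metric.closedBall w₀ ρ ×ˢ Metric.closedBall 0 C,
    (isCompact_closedBall _ _).prod (isCompact_closedBall _ _),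
    (convex_closedBall _ _).prod (convex_closedBall _ _),
    prod_mono hsubt (prod_mono hρt (subset_univ _)), ε / 2, hδ, hdom, fun a ha z hz => ?_⟩
  have hzdom := hdom (a • ·) a.edist_smul ha z hz
  have hmetric : ∀ z ∈ coordDomain (n := n) x₀ y₀ (a • ·), ∀ v w, _ := fun z hz v w =>
    metricInChart_coordRep_of_isometry x₀ y₀ (φ := (a • ·)) a.2.1 a.2.2.2 hz v w
  refine ⟨?_, (hclose (a • ·) a.edist_smul ha z hz).2, ?_⟩
  · exact hasFDerivAt_jet_of_isometry hg hg' (isOpen_coordDomain x₀ y₀ (φ := (a • ·)) a.2.1.continuous)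
      inter_subset_left (coordRep_mapsTo x₀ y₀ _) (contDiffOn_coordRep x₀ y₀ (φ := (a • ·)) a.2.1)
      hmetric hzdom
  · rw [mem_closedBall_zero_iff]
    have hw := (hclose (a • ·) a.edist_smul ha z hz).2
    refine hC (y := (z, coordRep x₀ y₀ (a • ·) z)) ?_ _ fun v => hmetric z hzdom v v
    rw [Prod.dist_eq]
    refine max_lt ?_ ?_
    · exact (lt_of_lt_of_le hz (min_le_right _ _)).trans (half_lt_self he)
    · exact (lt_of_le_of_lt (le_trans hw (min_le_right _ _)) (half_lt_self he))

end UniformJets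

lemma tendsto_clm_apply {X Y ι : Type*} [NormedAddCommGroup X] [NormedSpace ℝ X]
    [NormedAddCommGroup Y] [NormedSpace ℝ Y] {l : Filter ι} {T : ι → X →L[ℝ] Y} {T₀ : X →L[ℝ] Y}
    {v : ι → X} {v₀ : X} (hT : Tendsto T l (𝓝 T₀)) (hv : Tendsto v l (𝓝 v₀)) :
    Tendsto (fun i => T i (v i)) l (𝓝 (T₀ v₀)) :=
  ((isBoundedBilinearMap_apply (𝕜 := ℝ) (E := X) (F := Y)).continuous.tendsto (T₀, v₀)).comp
    (hT.prodMk_nhds hv)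

/-! ### Limits and compactness of isometries -/

section Limits

set_option synthInstance.maxHeartbeats 100000

variable {n : ℕ} {M : Type*} [EMetricSpace M]
  [ChartedSpace (EuclideanSpace ℝ (Fin n)) M] [IsManifold (𝓡 n) ∞ M]
  [RiemannianBundle (fun x : M => TangentSpace (𝓡 n) x)]
  [IsContMDiffRiemannianBundle (𝓡 n) ∞ (EuclideanSpace ℝ (Fin n))
      (fun x : M => TangentSpace (𝓡 n) x)]
  [IsRiemannianManifold (𝓡 n) M]

local notation "𝔼" => EuclideanSpace ℝ (Fin n)

omit [IsManifold (𝓡 n) ∞ M] [IsContMDiffRiemannianBundle (𝓡 n) ∞ (EuclideanSpace ℝ (Fin n))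
  (fun x : M => TangentSpace (𝓡 n) x)] in
lemma edist_eq_of_tendsto_isom {ι : Type*} {l : Filter ι} [l.NeBot] {a : ι → Isom n M} {φ : M → M}
    (h : ∀ p, Tendsto (fun i => a i • p) l (𝓝 (φ p))) (p q : M) :
    edist (φ p) (φ q) = edist p q :=
  tendsto_nhds_unique ((h p).edist (h q)) (tendsto_const_nhds.congr fun i =>
    ((a i).edist_smul p q).symm)

/-- A pointwise ultrafilter limit of isometries is a smooth isometry, and the differentials
converge. -/
lemma isometry_of_tendsto_isom {ι : Type*} (l : Ultrafilter ι) {a : ι → Isom n M} {φ : M → M}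
    (h : ∀ p, Tendsto (fun i => a i • p) l (𝓝 (φ p))) {x₀ y₀ x : M}
    (hx : x ∈ (extChartAt (𝓡 n) x₀).source) (hy : φ x ∈ (extChartAt (𝓡 n) y₀).source) :
    (ContMDiffAt (𝓡 n) (𝓡 n) ∞ φ x ∧ ∀ v w : TangentSpace (𝓡 n) x,
      ⟪mfderiv (𝓡 n) (𝓡 n) φ x v, mfderiv (𝓡 n) (𝓡 n) φ x w⟫_ℝ = ⟪v, w⟫_ℝ) ∧
    Tendsto (fun i => fderiv ℝ (coordRep x₀ y₀ (a i • ·)) (extChartAt (𝓡 n) x₀ x)) l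
      (𝓝 (fderiv ℝ (coordRep x₀ y₀ φ) (extChartAt (𝓡 n) x₀ x))) := by
  have hφ := edist_eq_of_tendsto_isom h
  obtain ⟨r, hr, K, hK, hKc, hsub, δ, hδ, hdom, hjet⟩ := exists_uniform_coordJet hx hy
  set z₀ := extChartAt (𝓡 n) x₀ x with hz₀
  have hg := isSmoothMetricOn_metricInChart (n := n) x₀
  have hg' := isSmoothMetricOn_metricInChart (n := n) y₀
  set Φ := isometryJetField (metricInChart (n := n) x₀) (metricInChart y₀) with hΦ
  have hΦs := contDiffOn_isometryJetField hg hg'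
  have hΩ : IsOpen ((extChartAt (𝓡 n) x₀).target ×ˢ
      ((extChartAt (𝓡 n) y₀).target ×ˢ (univ : Set (𝔼 →L[ℝ] 𝔼)))) :=
    hg.isOpen.prod (hg'.isOpen.prod isOpen_univ)
  have hev : ∀ᶠ i in l, edist (a i • x) (φ x) < δ := (h x).eventually (Metric.eball_mem_nhds _ hδ)
  obtain ⟨J, hJu, hJ⟩ := exists_tendstoUniformlyOn_of_totalDifferential hr hΩ hΦs hK hKc hsub l
    (J := fun i => coordJet x₀ y₀ (a i • ·)) (hev.mono fun i hi => hjet (a i) hi)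
  have hJs : ContDiffOn ℝ ∞ J (Metric.ball z₀ r) :=
    contDiffOn_of_totalDifferential Metric.isOpen_ball hΦs (fun z hz => (hJ z hz).1)
      fun z hz => hsub ⟨Metric.ball_subset_closedBall hz, (hJ z hz).2⟩
  have hφdom := hdom φ hφ (by simpa using hδ)
  -- Pointwise convergence identifies the first component of the limit jet with φ in coordinates.
  -- The jet equation then makes the second component its differential at z₀, and smoothness of J
  -- passes to φ.
  have hJ1 : ∀ z ∈ Metric.ball z₀ r, (J z).1 = coordRep x₀ y₀ φ z := by
    intro z hz
    refine tendsto_nhds_unique ((continuous_fst.tendsto _).comp (hJu.tendsto_at hz)) ?_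
    exact (continuousAt_extChartAt' (hφdom z hz).2).tendsto.comp (h _)
  have hball : ∀ {z}, z ∈ Metric.ball z₀ r → Metric.ball z₀ r ∈ 𝓝 z := fun hz =>
    Metric.isOpen_ball.mem_nhds hz
  have hz₀b : z₀ ∈ Metric.ball z₀ r := Metric.mem_ball_self hr
  have hd : HasFDerivAt (coordRep x₀ y₀ φ) (J z₀).2 z₀ := by
    have h1 : HasFDerivAt (fun z => (J z).1) (J z₀).2 z₀ := (hJ z₀ hz₀b).1.fst
    exact h1.congr_of_eventuallyEq (by
      filter_upwards [hball hz₀b] with z hz using (hJ1 z hz).symm)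
  have hlim : Tendsto (fun i => fderiv ℝ (coordRep x₀ y₀ (a i • ·)) z₀) l (𝓝 (J z₀).2) :=
    (continuous_snd.tendsto _).comp (hJu.tendsto_at hz₀b)
  have hlim1 : Tendsto (fun i => coordRep x₀ y₀ (a i • ·) z₀) l (𝓝 (coordRep x₀ y₀ φ z₀)) := by
    rw [← hJ1 z₀ hz₀b]
    exact (continuous_fst.tendsto _).comp (hJu.tendsto_at hz₀b)
  have hfs : ContDiffAt ℝ ∞ (coordRep (n := n) x₀ y₀ φ) z₀ :=
    (contDiff_fst.comp_contDiffAt _ (hJs.contDiffAt (hball hz₀b))).congr_of_eventuallyEq (by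
      filter_upwards [hball hz₀b] with z hz using (hJ1 z hz).symm)
  refine ⟨?_, by rwa [hd.fderiv]⟩
  have htgt := coordRep_mapsTo x₀ y₀ φ (hφdom z₀ hz₀b)
  refine isometry_at_of_coordinates hx hfs htgt ?_ fun v w => ?_
  · filter_upwards [hball hz₀b] with z hz
    exact ((extChartAt (𝓡 n) y₀).left_inv (hφdom z hz).2).symm
  · have hgc : ContinuousAt (metricInChart (n := n) y₀) (coordRep x₀ y₀ φ z₀) :=
      (hg'.contDiffOn.contDiffAt (hg'.isOpen.mem_nhds htgt)).continuousAt
    have h0 : Tendsto (fun i => metricInChart y₀ (coordRep x₀ y₀ (a i • ·) z₀)) l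
        (𝓝 (metricInChart (n := n) y₀ (coordRep x₀ y₀ φ z₀))) := hgc.tendsto.comp hlim1
    have hc : ∀ v, Tendsto (fun i => fderiv ℝ (coordRep x₀ y₀ (a i • ·)) z₀ v) l (𝓝 ((J z₀).2 v)) :=
      fun v => tendsto_clm_apply hlim tendsto_const_nhds
    have h1 := tendsto_clm_apply (tendsto_clm_apply h0 (hc v)) (hc w)
    rw [hd.fderiv]
    refine tendsto_nhds_unique h1 (tendsto_const_nhds.congr' ?_)
    filter_upwards [hev] with i hi
    exact (metricInChart_coordRep_of_isometry x₀ y₀ (φ := (a i • ·)) (a i).2.1 (a i).2.2.2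
      (hdom _ (a i).edist_smul hi z₀ hz₀b) v w).symm

omit [IsManifold (𝓡 n) ∞ M] [IsContMDiffRiemannianBundle (𝓡 n) ∞ (EuclideanSpace ℝ (Fin n))
  (fun x : M => TangentSpace (𝓡 n) x)] in
/-- If the images of one point under isometries stay in a compact set, the isometries converge
pointwise along ultrafilters. -/
lemma exists_tendsto_isom_of_compact [ConnectedSpace M] {ι : Type*} (l : Ultrafilter ι)
    {a : ι → Isom n M} {p : M} {C : Set M} (hC : IsCompact C) (hp : ∀ᶠ i in l, a i • p ∈ C) :
    ∃ φ : M → M, ∀ x, Tendsto (fun i => a i • x) l (𝓝 (φ x)) := by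
  have : LocallyCompactSpace M := ChartedSpace.locallyCompactSpace 𝔼 M
  set S : Set M := {x | ∃ y, Tendsto (fun i => a i • x) l (𝓝 y)} with hS
  have key : ∀ x : M, ∃ r > 0, ∀ x₁ ∈ Metric.eball x r, ∀ x₂ ∈ Metric.eball x r,
      x₁ ∈ S → x₂ ∈ S := by
    intro x
    obtain ⟨K, hK, hxK⟩ := exists_compact_mem_nhds x
    obtain ⟨R, hR, hRK⟩ := EMetric.mem_nhds_iff.1 hxK
    -- Five distances below R / 5 are chained: the fixed isometry a i₀ serves as reference, and (a
    -- i₀)⁻¹ moves a i • x₂ into the compact neighbourhood K of x.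
    refine ⟨R / 5, ENNReal.div_pos hR.ne' (by simp), ?_⟩
    rintro x₁ hx₁ x₂ hx₂ ⟨y, hy⟩
    have hr : 0 < R / 5 := ENNReal.div_pos hR.ne' (by simp)
    have hev : ∀ᶠ i in l, edist (a i • x₁) y < R / 5 := hy.eventually (Metric.eball_mem_nhds _ hr)
    obtain ⟨i₀, hi₀⟩ := hev.exists
    have hmem : ∀ᶠ i in l, a i • x₂ ∈ (a i₀ • ·) '' K := by
      filter_upwards [hev] with i hi
      refine ⟨(a i₀)⁻¹ • (a i • x₂), hRK ?_, by simp⟩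
      have e1 : edist (a i • x₂) (a i • x) < R / 5 := by rw [Isom.edist_smul]; exact hx₂
      have e2 : edist (a i • x) (a i • x₁) < R / 5 := by
        rw [Isom.edist_smul, edist_comm]; exact hx₁
      have e3 : edist y (a i₀ • x₁) < R / 5 := by rw [edist_comm]; exact hi₀
      have e4 : edist (a i₀ • x₁) (a i₀ • x) < R / 5 := by rw [Isom.edist_smul]; exact hx₁
      have e5 : edist ((a i₀)⁻¹ • (a i • x₂)) x = edist (a i • x₂) (a i₀ • x) := by
        rw [← (a i₀).edist_smul]; simp
      rw [Metric.mem_eball, e5]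
      have h5 : (R / 5 + R / 5 + R / 5 + R / 5 + R / 5 : ENNReal) = R := by
        calc _ = 5 * (R / 5) := by ring
          _ = R := ENNReal.mul_div_cancel (by simp) (by simp)
      refine lt_of_lt_of_eq ?_ h5
      refine (edist_triangle _ _ _).trans_lt (ENNReal.add_lt_add ?_ e4)
      refine (edist_triangle _ _ _).trans_lt (ENNReal.add_lt_add ?_ e3)
      refine (edist_triangle _ _ _).trans_lt (ENNReal.add_lt_add ?_ hi)
      exact (edist_triangle _ _ _).trans_lt (ENNReal.add_lt_add e1 e2)
    obtain ⟨y₂, -, hy₂⟩ := (hK.image (a i₀).2.1.continuous).ultrafilter_le_nhds'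
      (l.map fun i => a i • x₂) hmem
    exact ⟨y₂, hy₂⟩
  have hopen : IsOpen S := EMetric.isOpen_iff.2 fun x hx => by
    obtain ⟨r, hr, h⟩ := key x
    exact ⟨r, hr, fun x' hx' => h x (Metric.mem_eball_self hr) x' hx' hx⟩
  have hclosed : IsClosed S := ⟨EMetric.isOpen_iff.2 fun x hx => by
    obtain ⟨r, hr, h⟩ := key x
    exact ⟨r, hr, fun x' hx' hx'S => hx (h x' hx' x (Metric.mem_eball_self hr) hx'S)⟩⟩
  obtain ⟨q, -, hq⟩ := hC.ultrafilter_le_nhds' (l.map fun i => a i • p) hp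
  have huniv : S = univ := IsClopen.eq_univ ⟨hclosed, hopen⟩ ⟨p, q, hq⟩
  have hall : ∀ x, ∃ y, Tendsto (fun i => a i • x) l (𝓝 y) := fun x => by
    have : x ∈ S := huniv ▸ mem_univ x
    exact this
  exact ⟨fun x => (hall x).choose, fun x => (hall x).choose_spec⟩

lemma contMDiff_of_tendsto_isom {ι : Type*} (l : Ultrafilter ι) {a : ι → Isom n M} {φ : M → M}
    (h : ∀ p, Tendsto (fun i => a i • p) l (𝓝 (φ p))) :
    ContMDiff (𝓡 n) (𝓡 n) ∞ φ ∧ ∀ (x : M) (v w : TangentSpace (𝓡 n) x),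
      ⟪mfderiv (𝓡 n) (𝓡 n) φ x v, mfderiv (𝓡 n) (𝓡 n) φ x w⟫_ℝ = ⟪v, w⟫_ℝ :=
  ⟨fun x => (isometry_of_tendsto_isom l h (mem_extChartAt_source x)
    (mem_extChartAt_source (φ x))).1.1, fun x => (isometry_of_tendsto_isom l h
      (mem_extChartAt_source x) (mem_extChartAt_source (φ x))).1.2⟩

/-- Isometries that move one point within a compact set subconverge to isometries. -/
lemma exists_isom_tendsto [ConnectedSpace M] {ι : Type*} (l : Ultrafilter ι)
    {a : ι → Isom n M} {p : M} {C : Set M} (hC : IsCompact C) (hp : ∀ᶠ i in l, a i • p ∈ C) :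
    ∃ b : Isom n M, ∀ x, Tendsto (fun i => a i • x) l (𝓝 (b • x : M)) := by
  obtain ⟨φ, hφ⟩ := exists_tendsto_isom_of_compact l hC hp
  -- Hence the inverses move φ p within a compact neighbourhood of p, so they converge too; their
  -- limit is a two-sided inverse of φ.
  have hinv : ∀ x, Tendsto (fun i => (a i)⁻¹ • φ x) l (𝓝 x) := by
    intro x
    rw [tendsto_iff_edist_tendsto_0]
    have h1 := tendsto_iff_edist_tendsto_0.1 (hφ x)
    refine h1.congr fun i => ?_
    rw [← (a i).edist_smul ((a i)⁻¹ • φ x), smul_inv_smul, edist_comm]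
  have : LocallyCompactSpace M := ChartedSpace.locallyCompactSpace 𝔼 M
  obtain ⟨K, hK, hpK⟩ := exists_compact_mem_nhds p
  obtain ⟨ψ, hψ⟩ := exists_tendsto_isom_of_compact l (a := fun i => (a i)⁻¹) hK
    ((hinv p).eventually hpK)
  have hl : ∀ x, ψ (φ x) = x := fun x => tendsto_nhds_unique (hψ (φ x)) (hinv x)
  have hr : ∀ x, φ (ψ x) = x := fun x => by
    have h1 : Tendsto (fun i => a i • ψ x) l (𝓝 x) := by
      rw [tendsto_iff_edist_tendsto_0]
      refine (tendsto_iff_edist_tendsto_0.1 (hψ x)).congr fun i => ?_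
      rw [← (a i).edist_smul ((a i)⁻¹ • x), smul_inv_smul, edist_comm]
    exact tendsto_nhds_unique (hφ (ψ x)) h1
  have hφs := contMDiff_of_tendsto_isom l hφ
  have hψs := contMDiff_of_tendsto_isom l hψ
  exact ⟨⟨⟨φ, ψ, hl, hr⟩, hφs.1, hψs.1, hφs.2⟩, hφ⟩

end Limits

/-! ### The compact-open topology on the isometry group -/

section Topology

variable {n : ℕ} {M : Type*} [EMetricSpace M]
  [ChartedSpace (EuclideanSpace ℝ (Fin n)) M] [IsManifold (𝓡 n) ∞ M]
  [RiemannianBundle (fun x : M => TangentSpace (𝓡 n) x)]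

omit [IsManifold (𝓡 n) ∞ M] in
lemma Isom.continuous_smul_const (x : M) : Continuous fun a : Isom n M => (a • x : M) :=
  have h : Continuous (Isom.toContinuousMap : Isom n M → C(M, M)) := continuous_induced_dom
  (continuous_eval_const (F := C(M, M)) x).comp h

omit [IsManifold (𝓡 n) ∞ M] in
lemma Isom.ext_smul {a b : Isom n M} (h : ∀ x : M, a • x = b • x) : a = b :=
  Subtype.ext (Equiv.ext h)

instance : T2Space (Isom n M) :=
  T2Space.of_injective_continuous (f := Isom.toContinuousMap)
    (fun _ _ h => Isom.ext_smul fun x => congrArg (fun f : C(M, M) => f x) h)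
    continuous_induced_dom

instance : ContinuousMul (Isom n M) where
  continuous_mul := by
    have : LocallyCompactSpace M := ChartedSpace.locallyCompactSpace (EuclideanSpace ℝ (Fin n)) M
    refine continuous_induced_rng.2 ?_
    have h : Continuous (Isom.toContinuousMap : Isom n M → C(M, M)) := continuous_induced_dom
    exact (h.comp continuous_fst).compCM (h.comp continuous_snd)

variable [IsRiemannianManifold (𝓡 n) M]

omit [IsManifold (𝓡 n) ∞ M] in
/-- Pointwise convergence of isometries is convergence in the compact-open topology. -/
lemma Isom.tendsto_of_forall_tendsto_smul {ι : Type*} {l : Filter ι} {a : ι → Isom n M}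
    {b : Isom n M} (h : ∀ x, Tendsto (fun i => a i • x) l (𝓝 (b • x : M))) : Tendsto a l (𝓝 b) := by
  have : LocallyCompactSpace M := ChartedSpace.locallyCompactSpace (EuclideanSpace ℝ (Fin n)) M
  rw [nhds_induced, tendsto_comap_iff, ContinuousMap.tendsto_iff_tendstoLocallyUniformly,
    EMetric.tendstoLocallyUniformly_iff]
  intro ε hε x
  have hε3 : 0 < ε / 3 := ENNReal.div_pos hε.ne' (by simp)
  -- Isometries are equicontinuous, so one radius ε / 3 serves for every a i and for b.
  refine ⟨Metric.eball x (ε / 3), Metric.eball_mem_nhds x hε3, ?_⟩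
  filter_upwards [(h x).eventually (Metric.eball_mem_nhds _ hε3)] with i hi y hy
  have e1 : edist (b • y) (b • x) < ε / 3 := by rw [Isom.edist_smul]; exact hy
  have e2 : edist (b • x) (a i • x) < ε / 3 := by rw [edist_comm]; exact hi
  have e3 : edist (a i • x) (a i • y) < ε / 3 := by rw [Isom.edist_smul, edist_comm]; exact hy
  have h3 : (ε / 3 + ε / 3 + ε / 3 : ENNReal) = ε := ENNReal.add_thirds ε
  refine lt_of_lt_of_eq ?_ h3
  refine (edist_triangle (b • y) _ _).trans_lt (ENNReal.add_lt_add ?_ e3)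
  exact (edist_triangle _ _ _).trans_lt (ENNReal.add_lt_add e1 e2)

end Topology

/-! ### An isometry is determined by its 1-jet -/

section Uniqueness

set_option synthInstance.maxHeartbeats 100000

variable {n : ℕ} {M : Type*} [EMetricSpace M]
  [ChartedSpace (EuclideanSpace ℝ (Fin n)) M] [IsManifold (𝓡 n) ∞ M]
  [RiemannianBundle (fun x : M => TangentSpace (𝓡 n) x)]
  [IsContMDiffRiemannianBundle (𝓡 n) ∞ (EuclideanSpace ℝ (Fin n))
      (fun x : M => TangentSpace (𝓡 n) x)]
  [IsRiemannianManifold (𝓡 n) M]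

/-- The differential of an isometry at a point depends continuously on the isometry. -/
lemma Isom.continuousAt_fderiv_coordRep {x₀ y₀ x : M} {b : Isom n M}
    (hx : x ∈ (extChartAt (𝓡 n) x₀).source) (hy : b • x ∈ (extChartAt (𝓡 n) y₀).source) :
    ContinuousAt (fun a : Isom n M =>
      fderiv ℝ (coordRep x₀ y₀ (a • ·)) (extChartAt (𝓡 n) x₀ x)) b := by
  rw [continuousAt_iff_ultrafilter]
  intro l hl
  exact (isometry_of_tendsto_isom l (a := id) (φ := (b • ·))
    (fun p => ((Isom.continuous_smul_const p).tendsto b).mono_left hl) hx hy).2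

/-- Isometries with the same one-jet at a point agree near the point. -/
lemma Isom.eventuallyEq_of_fderiv_eq {a b : Isom n M} {x : M} (hab : a • x = b • x) {x₀ y₀ : M}
    (hx : x ∈ (extChartAt (𝓡 n) x₀).source) (hy : a • x ∈ (extChartAt (𝓡 n) y₀).source)
    (hd : fderiv ℝ (coordRep x₀ y₀ (a • ·)) (extChartAt (𝓡 n) x₀ x) =
      fderiv ℝ (coordRep x₀ y₀ (b • ·)) (extChartAt (𝓡 n) x₀ x)) :
    (a • · : M → M) =ᶠ[𝓝 x] (b • ·) := by
  obtain ⟨r, hr, K, hK, hKc, hsub, δ, hδ, hdom, hjet⟩ := exists_uniform_coordJet hx hy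
  have hg := isSmoothMetricOn_metricInChart (n := n) x₀
  have hg' := isSmoothMetricOn_metricInChart (n := n) y₀
  obtain ⟨L, hL⟩ := (contDiffOn_isometryJetField hg hg').exists_lipschitzOnWith_of_isCompact
    (hg.isOpen.prod (hg'.isOpen.prod isOpen_univ)) ((isCompact_closedBall _ _).prod hK)
    ((convex_closedBall _ _).prod hKc) hsub
  have ha : edist (a • x) (a • x) < δ := by simpa using hδ
  have hb : edist (b • x) (a • x) < δ := by simpa [hab] using hδ
  have hJ0 : coordJet x₀ y₀ (a • ·) (extChartAt (𝓡 n) x₀ x) =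
      coordJet x₀ y₀ (b • ·) (extChartAt (𝓡 n) x₀ x) := by
    refine Prod.ext ?_ hd
    simp only [coordJet, coordRep, (extChartAt (𝓡 n) x₀).left_inv hx, hab]
  filter_upwards [(continuousAt_extChartAt' hx).preimage_mem_nhds (Metric.ball_mem_nhds _ hr),
    (isOpen_extChartAt_source x₀).mem_nhds hx] with x' hx' hx's
  -- Two solutions of the same jet equation with equal value at the center coincide.
  have h := norm_sub_le_of_totalDifferential hL (hjet a ha) (hjet b hb) hx'
  rw [hJ0, sub_self, norm_zero, zero_mul] at h
  have h2 := congrArg Prod.fst (sub_eq_zero.1 (norm_le_zero_iff.1 h))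
  have da := (hdom _ a.edist_smul ha _ hx').2
  have db := (hdom _ b.edist_smul hb _ hx').2
  simp only [coordJet, coordRep, mem_ofPred_eq, (extChartAt (𝓡 n) x₀).left_inv hx's] at h2 da db
  exact (extChartAt (𝓡 n) y₀).injOn da db h2

/-- Isometries of a connected manifold with the same one-jet at a point are equal. -/
lemma Isom.eq_of_fderiv_eq [ConnectedSpace M] {a b : Isom n M} {x : M} (hab : a • x = b • x)
    {x₀ y₀ : M} (hx : x ∈ (extChartAt (𝓡 n) x₀).source)
    (hy : a • x ∈ (extChartAt (𝓡 n) y₀).source)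
    (hd : fderiv ℝ (coordRep x₀ y₀ (a • ·)) (extChartAt (𝓡 n) x₀ x) =
      fderiv ℝ (coordRep x₀ y₀ (b • ·)) (extChartAt (𝓡 n) x₀ x)) : a = b := by
  set S : Set M := {y | (a • · : M → M) =ᶠ[𝓝 y] (b • ·)} with hS
  have hopen : IsOpen S := isOpen_setOfPred_eventually_nhds
  -- At a point y of the closure, values and differentials of a and b agree at points of S
  -- arbitrarily near y, hence at y by continuity. The local statement then puts y in S.
  have hclosed : IsClosed S := by
    refine isClosed_of_closure_subset fun y hyS => ?_
    have hfreq := mem_closure_iff_frequently.1 hyS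
    have hca : Continuous (a • · : M → M) := a.2.1.continuous
    have hcb : Continuous (b • · : M → M) := b.2.1.continuous
    have hy1 : a • y = b • y := tendsto_nhds_unique_of_frequently_eq (hca.tendsto y) (hcb.tendsto y)
      (hfreq.mono fun z hz => hz.self_of_nhds)
    have hys := mem_extChartAt_source (I := 𝓡 n) y
    have hays := mem_extChartAt_source (I := 𝓡 n) (a • y)
    have hda := extChartAt_mem_coordDomain (φ := (a • ·)) hys hays
    have hdb := extChartAt_mem_coordDomain (φ := (b • ·)) (y₀ := a • y) hys (by rw [← hy1]; exact hays)
    have cont : ∀ c : Isom n M, extChartAt (𝓡 n) y y ∈ coordDomain (n := n) y (a • y) (c • ·) →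
        ContinuousAt (fderiv ℝ (coordRep (n := n) y (a • y) (c • ·))) (extChartAt (𝓡 n) y y) := by
      intro c hc
      have ho := isOpen_coordDomain (n := n) y (a • y) (φ := (c • ·)) c.2.1.continuous
      exact ((contDiffOn_coordRep y (a • y) (φ := (c • ·)) c.2.1).continuousOn_fderiv_of_isOpen ho
        (by simp)).continuousAt (ho.mem_nhds hc)
    refine Isom.eventuallyEq_of_fderiv_eq hy1 hys hays
      (tendsto_nhds_unique_of_frequently_eq (cont a hda).tendsto (cont b hdb).tendsto ?_)
    have hsrc := (isOpen_extChartAt_source (I := 𝓡 n) y).mem_nhds hys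
    refine (continuousAt_extChartAt' hys).tendsto.frequently
      ((hfreq.and_eventually hsrc).mono fun z hz => ?_)
    refine Filter.EventuallyEq.fderiv_eq ?_
    have hsymm : Tendsto (extChartAt (𝓡 n) y).symm (𝓝 (extChartAt (𝓡 n) y z)) (𝓝 z) := by
      have h := continuousAt_extChartAt_symm'' (I := 𝓡 n) ((extChartAt (𝓡 n) y).map_source hz.2)
      rwa [ContinuousAt, (extChartAt (𝓡 n) y).left_inv hz.2] at h
    filter_upwards [hsymm.eventually hz.1] with w hw
    exact congrArg (extChartAt (𝓡 n) (a • y)) hw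
  have huniv : S = univ := IsClopen.eq_univ ⟨hclosed, hopen⟩
    ⟨x, Isom.eventuallyEq_of_fderiv_eq hab hx hy hd⟩
  refine Isom.ext_smul fun y => ?_
  have hyS : y ∈ S := huniv ▸ mem_univ y
  exact hyS.self_of_nhds

end Uniqueness

/-! ### Parallel transport as a fundamental solution -/

section Frames

variable {𝔸 : Type*} [NormedRing 𝔸] [NormedAlgebra ℝ 𝔸] [CompleteSpace 𝔸]

/-- Local fundamental solution `P` of `P' = -B P`, together with its inverse `Q`. -/
lemma exists_fundamental_solution {B : ℝ → 𝔸} (hB : ContDiffAt ℝ 1 B 0) :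
    ∃ ε > 0, ∃ P Q : ℝ → 𝔸, P 0 = 1 ∧ Q 0 = 1 ∧ ∀ t, |t| < ε →
      HasDerivAt P (-(B t * P t)) t ∧ HasDerivAt Q (Q t * B t) t ∧ P t * Q t = 1 := by
  -- Time is added as a coordinate with derivative 1, which makes the system autonomous.
  have hv : ContDiffAt ℝ 1 (fun x : ℝ × (𝔸 × 𝔸) => ((1 : ℝ), (-(B x.1 * x.2.1), x.2.2 * B x.1)))
      ((0 : ℝ), ((1 : 𝔸), (1 : 𝔸))) := by
    have h1 : ContDiffAt ℝ 1 (fun x : ℝ × (𝔸 × 𝔸) => B x.1) ((0 : ℝ), ((1 : 𝔸), (1 : 𝔸))) :=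
      ContDiffAt.comp _ hB contDiffAt_fst
    have h2 : ContDiffAt ℝ 1 (fun x : ℝ × (𝔸 × 𝔸) => x.2.1) ((0 : ℝ), ((1 : 𝔸), (1 : 𝔸))) :=
      contDiffAt_snd.fst
    have h3 : ContDiffAt ℝ 1 (fun x : ℝ × (𝔸 × 𝔸) => x.2.2) ((0 : ℝ), ((1 : 𝔸), (1 : 𝔸))) :=
      contDiffAt_snd.snd
    exact contDiffAt_const.prodMk ((h1.mul h2).neg.prodMk (h3.mul h1))
  obtain ⟨α, hα0, ε, hε, hα⟩ :=
    hv.exists_forall_mem_closedBall_exists_eq_forall_mem_Ioo_hasDerivAt₀ 0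
  simp only [zero_sub, zero_add] at hα
  have hα1 : ∀ t ∈ Ioo (-ε) ε, (α t).1 = t := by
    have h0 : (0 : ℝ) ∈ Ioo (-ε) ε := ⟨by linarith, hε⟩
    have hd : ∀ t ∈ Ioo (-ε) ε, HasDerivAt (fun t => (α t).1) 1 t := fun t ht => by
      simpa using (hα t ht).hasFDerivAt.fst.hasDerivAt
    refine isOpen_Ioo.eqOn_of_deriv_eq (𝕜 := ℝ) isPreconnected_Ioo (f := fun t => (α t).1)
      (g := fun t => t)
      (fun t ht => (hd t ht).differentiableAt.differentiableWithinAt) differentiableOn_id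
      (fun t ht => ?_) h0 (by simp [hα0])
    rw [(hd t ht).deriv]
    simp
  have hP : ∀ t ∈ Ioo (-ε) ε, HasDerivAt (fun t => (α t).2.1) (-(B t * (α t).2.1)) t := by
    intro t ht
    have := (hα t ht).snd.fst
    rwa [hα1 t ht] at this
  have hQ : ∀ t ∈ Ioo (-ε) ε, HasDerivAt (fun t => (α t).2.2) ((α t).2.2 * B t) t := by
    intro t ht
    have := (hα t ht).snd.snd
    rwa [hα1 t ht] at this
  have h0 : (0 : ℝ) ∈ Ioo (-ε) ε := ⟨by linarith, hε⟩
  have hQP : ∀ t ∈ Ioo (-ε) ε, (α t).2.2 * (α t).2.1 = 1 := by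
    have hd : ∀ t ∈ Ioo (-ε) ε, HasDerivAt (fun t => (α t).2.2 * (α t).2.1) 0 t := by
      intro t ht
      refine ((hQ t ht).mul (hP t ht)).congr_deriv ?_
      noncomm_ring
    intro t ht
    have := isOpen_Ioo.is_const_of_deriv_eq_zero (𝕜 := ℝ) isPreconnected_Ioo
      (fun t ht => (hd t ht).differentiableAt.differentiableWithinAt)
      (fun t ht => (hd t ht).deriv) ht h0
    simpa [hα0] using this
  -- Constancy gives only Q P = 1. The reverse product needs Q to be invertible, which holds near Q
  -- 0 = 1; hence the second radius ε'.
  have hunit : ∀ᶠ t in 𝓝 (0 : ℝ), IsUnit (α t).2.2 := by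
    refine (hQ 0 h0).continuousAt.eventually (p := IsUnit) ?_
    simp only [hα0]
    exact Units.isOpen.mem_nhds isUnit_one
  obtain ⟨ε', hε', hu⟩ := Metric.eventually_nhds_iff.1 hunit
  refine ⟨min ε ε', lt_min hε hε', fun t => (α t).2.1, fun t => (α t).2.2, by simp [hα0],
    by simp [hα0], fun t ht => ?_⟩
  have ht1 : t ∈ Ioo (-ε) ε := abs_lt.1 (ht.trans_le (min_le_left _ _))
  refine ⟨hP t ht1, hQ t ht1, ?_⟩
  obtain ⟨u, hu⟩ := hu (y := t) (by simpa using ht.trans_le (min_le_right _ _))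
  have h1 := hQP t ht1
  simp only at h1 ⊢
  rw [← hu] at h1 ⊢
  have : (α t).2.1 = ↑u⁻¹ := by
    rw [← one_mul (α t).2.1, ← u.inv_mul, mul_assoc, h1, mul_one]
  rw [this, u.inv_mul]

omit [CompleteSpace 𝔸] in
/-- Conjugating by fundamental solutions turns solutions of `F' = F B - B(· + s) F` into constants. -/
lemma conj_fundamental_solution_eq {B P Q F : ℝ → 𝔸} {ε s : ℝ} (hε : 0 < ε) (hs : |s| < ε)
    (hP0 : P 0 = 1)
    (hPQ : ∀ t, |t| < 2 * ε → HasDerivAt P (-(B t * P t)) t ∧ HasDerivAt Q (Q t * B t) t)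
    (hF : ∀ t, |t| < ε → HasDerivAt F (F t * B t - B (t + s) * F t) t) {t : ℝ} (ht : |t| < ε) :
    Q (t + s) * F t * P t = Q s * F 0 := by
  have h0 : (0 : ℝ) ∈ Ioo (-ε) ε := ⟨by linarith, hε⟩
  have hd : ∀ t ∈ Ioo (-ε) ε, HasDerivAt (fun t => Q (t + s) * F t * P t) 0 t := by
    intro t ht
    have ht' : |t| < ε := abs_lt.2 ht
    have hts : |t + s| < 2 * ε := (abs_add_le t s).trans_lt (by linarith)
    have hQ := (hPQ (t + s) hts).2.comp_add_const t s
    refine ((hQ.mul (hF t ht')).mul (hPQ t (by linarith)).1).congr_deriv ?_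
    simp only [Pi.mul_apply]
    noncomm_ring
  have := isOpen_Ioo.is_const_of_deriv_eq_zero (𝕜 := ℝ) isPreconnected_Ioo
    (fun t ht => (hd t ht).differentiableAt.differentiableWithinAt)
    (fun t ht => (hd t ht).deriv) (abs_lt.1 ht : t ∈ Ioo (-ε) ε) h0
  simpa [hP0] using this

end Frames

/-! ### The group of translations of a curve -/

section Translations

set_option synthInstance.maxHeartbeats 100000

variable {n : ℕ} {M : Type*} [EMetricSpace M]
  [ChartedSpace (EuclideanSpace ℝ (Fin n)) M] [IsManifold (𝓡 n) ∞ M]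
  [RiemannianBundle (fun x : M => TangentSpace (𝓡 n) x)]

local notation "𝔼" => EuclideanSpace ℝ (Fin n)

/-- The group of pairs `(a, s)` where the isometry `a` moves the curve `γ` along itself by `s`. -/
def translationGroup (γ : ℝ → M) : Subgroup (Isom n M × Multiplicative ℝ) where
  carrier := {g | ∀ t, g.1 • γ t = γ (t + g.2.toAdd)}
  one_mem' := fun t => by simp
  mul_mem' := fun {g h} hg hh t => by
    simp only [Prod.fst_mul, Prod.snd_mul, toAdd_mul, mul_smul]
    rw [hh, hg]
    ring_nf
  inv_mem' := fun {g} hg t => by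
    simp only [Prod.fst_inv, Prod.snd_inv, toAdd_inv]
    rw [inv_smul_eq_iff, hg]
    simp

omit [IsManifold (𝓡 n) ∞ M] in
lemma translationGroup_smul {γ : ℝ → M} (g : translationGroup (n := n) γ) (t : ℝ) :
    g.1.1 • γ t = γ (t + g.1.2.toAdd) := g.2 t

instance (γ : ℝ → M) : ContinuousMul (translationGroup (n := n) γ) :=
  inferInstanceAs (ContinuousMul (translationGroup (n := n) γ).toSubmonoid)

variable [IsContMDiffRiemannianBundle (𝓡 n) ∞ (EuclideanSpace ℝ (Fin n))
      (fun x : M => TangentSpace (𝓡 n) x)]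
  [IsRiemannianManifold (𝓡 n) M]

/-- Isometries with shift in [-R, R] send γ 0 into the compact arc γ([-R, R]), so they converge
along ultrafilters; the translation relation passes to the limit. -/
lemma isCompact_translationGroup [ConnectedSpace M] {γ : ℝ → M} (hγ : Continuous γ) (R : ℝ) :
    IsCompact {g : translationGroup (n := n) γ | |g.1.2.toAdd| ≤ R} := by
  rw [isCompact_iff_ultrafilter_le_nhds']
  intro l hl
  have hev : ∀ᶠ g in (l : Filter (translationGroup (n := n) γ)), g.1.2.toAdd ∈ Icc (-R) R :=
    Filter.mem_of_superset hl fun g hg => abs_le.1 hg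
  obtain ⟨b, hb⟩ := exists_isom_tendsto l (a := fun g => g.1.1) (p := γ 0)
    (isCompact_Icc.image hγ : IsCompact (γ '' Icc (-R) R)) (by
      filter_upwards [hev] with g hg
      exact ⟨g.1.2.toAdd, hg, by rw [translationGroup_smul, zero_add]⟩)
  obtain ⟨σ, hσR, hσ⟩ := (isCompact_Icc (a := -R) (b := R)).ultrafilter_le_nhds'
    (l.map fun g : translationGroup (n := n) γ => g.1.2.toAdd) hev
  replace hσ : Tendsto (fun g : translationGroup (n := n) γ => g.1.2.toAdd) l (𝓝 σ) := hσ
  have hmem : ∀ t, b • γ t = γ (t + σ) := fun t =>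
    tendsto_nhds_unique (hb (γ t)) (((hγ.tendsto _).comp (hσ.const_add t)).congr fun g =>
      (translationGroup_smul g t).symm)
  refine ⟨⟨(b, .ofAdd σ), hmem⟩, abs_le.2 hσR, ?_⟩
  have h1 : Tendsto (fun g : translationGroup (n := n) γ => g.1) l (𝓝 (b, .ofAdd σ)) :=
    (Isom.tendsto_of_forall_tendsto_smul hb).prodMk_nhds
      ((continuous_ofAdd.tendsto σ).comp hσ)
  exact tendsto_subtype_rng.2 h1

end Translations

/-! ### The local linear model along the curve -/

section Holonomy

set_option synthInstance.maxHeartbeats 100000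

variable {n : ℕ} {M : Type*} [EMetricSpace M]
  [ChartedSpace (EuclideanSpace ℝ (Fin n)) M] [IsManifold (𝓡 n) ∞ M]
  [RiemannianBundle (fun x : M => TangentSpace (𝓡 n) x)]

local notation "𝔼" => EuclideanSpace ℝ (Fin n)

/-- A curve read in the chart at its initial point. -/
def chartCurve (γ : ℝ → M) (t : ℝ) : 𝔼 := extChartAt (𝓡 n) (γ 0) (γ t)

/-- The connection form of the curve `γ` in the chart at its initial point. -/
def connectionAlong (γ : ℝ → M) (t : ℝ) : 𝔼 →L[ℝ] 𝔼 :=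
  christoffelSharp (metricInChart (γ 0)) (chartCurve (n := n) γ t) (deriv (chartCurve (n := n) γ) t)

/-- The differential of a map along `γ` in the chart at the initial point. -/
def fderivAlong (γ : ℝ → M) (φ : M → M) (t : ℝ) : 𝔼 →L[ℝ] 𝔼 :=
  fderiv ℝ (coordRep (γ 0) (γ 0) φ) (chartCurve (n := n) γ t)

variable {γ : ℝ → M}

omit [RiemannianBundle (fun x : M => TangentSpace (𝓡 n) x)] in
lemma contDiffOn_chartCurve (hγ : ContMDiff 𝓘(ℝ, ℝ) (𝓡 n) ∞ γ) :
    ContDiffOn ℝ ∞ (chartCurve (n := n) γ) (γ ⁻¹' (extChartAt (𝓡 n) (γ 0)).source) := by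
  rw [← contMDiffOn_iff_contDiffOn]
  have h1 : ContMDiffOn (𝓡 n) (𝓡 n) ∞ (extChartAt (𝓡 n) (γ 0)) (extChartAt (𝓡 n) (γ 0)).source := by
    rw [extChartAt_source]; exact contMDiffOn_extChartAt
  exact h1.comp hγ.contMDiffOn fun t ht => ht

omit [IsManifold (𝓡 n) ∞ M] [RiemannianBundle (fun x : M => TangentSpace (𝓡 n) x)] in
lemma isOpen_preimage_source (hγ : Continuous γ) :
    IsOpen (γ ⁻¹' (extChartAt (𝓡 n) (γ 0)).source) :=
  (isOpen_extChartAt_source (γ 0)).preimage hγ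

variable [IsContMDiffRiemannianBundle (𝓡 n) ∞ (EuclideanSpace ℝ (Fin n))
      (fun x : M => TangentSpace (𝓡 n) x)]

lemma contDiffAt_connectionAlong (hγ : ContMDiff 𝓘(ℝ, ℝ) (𝓡 n) ∞ γ) :
    ContDiffAt ℝ 1 (connectionAlong (n := n) γ) 0 := by
  have ho := isOpen_preimage_source (n := n) hγ.continuous
  have h0 : (0 : ℝ) ∈ γ ⁻¹' (extChartAt (𝓡 n) (γ 0)).source := mem_extChartAt_source (γ 0)
  have hc := contDiffOn_chartCurve hγ
  have hc' : ContDiffOn ℝ ∞ (deriv (chartCurve (n := n) γ)) _ := hc.deriv_of_isOpen ho (by simp)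
  have hΓ := (isSmoothMetricOn_metricInChart (n := n) (γ 0)).contDiffOn_christoffelSharp
  have h := (hΓ.comp hc fun t ht => (extChartAt (𝓡 n) (γ 0)).map_source ht).clm_apply hc'
  exact (h.contDiffAt (ho.mem_nhds h0)).of_le (by simp)

/-- The differential of an isometry that translates `γ` satisfies a linear equation along `γ`. -/
lemma hasDerivAt_fderivAlong (hγ : ContMDiff 𝓘(ℝ, ℝ) (𝓡 n) ∞ γ) {a : Isom n M} {s t : ℝ}
    (ha : ∀ u, a • γ u = γ (u + s)) (ht : γ t ∈ (extChartAt (𝓡 n) (γ 0)).source)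
    (hts : γ (t + s) ∈ (extChartAt (𝓡 n) (γ 0)).source) :
    HasDerivAt (fderivAlong (n := n) γ (a • ·))
      (fderivAlong γ (a • ·) t * connectionAlong γ t -
        connectionAlong γ (t + s) * fderivAlong γ (a • ·) t) t := by
  have ho := isOpen_preimage_source (n := n) hγ.continuous
  have hc : ∀ u, γ u ∈ (extChartAt (𝓡 n) (γ 0)).source →
      HasDerivAt (chartCurve (n := n) γ) (deriv (chartCurve (n := n) γ) u) u := fun u hu =>
    (((contDiffOn_chartCurve hγ).contDiffAt (ho.mem_nhds hu)).differentiableAt (by simp)).hasDerivAt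
  have hg := isSmoothMetricOn_metricInChart (n := n) (γ 0)
  have hdom : chartCurve γ t ∈ coordDomain (n := n) (γ 0) (γ 0) (a • ·) :=
    extChartAt_mem_coordDomain ht (by rwa [ha])
  have hjet := hasFDerivAt_jet_of_isometry hg hg
    (isOpen_coordDomain (γ 0) (γ 0) (φ := (a • ·)) a.2.1.continuous)
    inter_subset_left (coordRep_mapsTo (γ 0) (γ 0) _)
    (contDiffOn_coordRep (γ 0) (γ 0) (φ := (a • ·)) a.2.1)
    (fun z hz v w => metricInChart_coordRep_of_isometry (γ 0) (γ 0) (φ := (a • ·)) a.2.1 a.2.2.2 hz v w)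
    hdom
  have hcomm : ∀ u, γ u ∈ (extChartAt (𝓡 n) (γ 0)).source →
      coordRep (γ 0) (γ 0) (a • ·) (chartCurve γ u) = chartCurve (n := n) γ (u + s) := fun u hu => by
    simp only [coordRep, chartCurve, (extChartAt (𝓡 n) (γ 0)).left_inv hu, ha]
  -- The differential carries the velocity at t to that at t + s, so the target Christoffel term in
  -- the jet equation becomes the connection form at t + s.
  have hfst : fderivAlong γ (a • ·) t (deriv (chartCurve (n := n) γ) t) =
      deriv (chartCurve (n := n) γ) (t + s) := by
    have h1 : HasDerivAt (fun u => coordRep (γ 0) (γ 0) (a • ·) (chartCurve (n := n) γ u))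
        (fderivAlong γ (a • ·) t (deriv (chartCurve (n := n) γ) t)) t :=
      hjet.fst.comp_hasDerivAt t (hc t ht)
    have h2 : HasDerivAt (fun u => chartCurve (n := n) γ (u + s))
        (deriv (chartCurve (n := n) γ) (t + s)) t := (hc (t + s) hts).comp_add_const t s
    refine h1.unique (h2.congr_of_eventuallyEq ?_)
    filter_upwards [ho.mem_nhds ht] with u hu using hcomm u hu
  have h := hjet.snd.comp_hasDerivAt t (hc t ht)
  refine HasDerivAt.congr_deriv h ?_
  ext1 v
  have h2 := isometryJetField_apply_snd (metricInChart (n := n) (γ 0)) (metricInChart (γ 0))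
    (chartCurve γ t) (coordRep (γ 0) (γ 0) (a • ·) (chartCurve γ t)) (fderivAlong γ (a • ·) t)
    (deriv (chartCurve (n := n) γ) t) v
  rw [hcomm t ht, hfst] at h2
  rw [← hcomm t ht] at h2
  refine Eq.trans h2 ?_
  rw [hcomm t ht]
  rfl

-- The chain rule at γ 0: the hypotheses keep both the intermediate point γ u and its image in the
-- single chart used throughout.
omit [IsContMDiffRiemannianBundle (𝓡 n) ∞ (EuclideanSpace ℝ (Fin n))
  (fun x : M => TangentSpace (𝓡 n) x)] in
lemma fderivAlong_mul {a b : Isom n M} {u : ℝ} (hb : b • γ 0 = γ u)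
    (hu : γ u ∈ (extChartAt (𝓡 n) (γ 0)).source)
    (hau : a • γ u ∈ (extChartAt (𝓡 n) (γ 0)).source) :
    fderivAlong (n := n) γ ((a * b) • ·) 0 = fderivAlong γ (a • ·) u * fderivAlong γ (b • ·) 0 := by
  have h0 := mem_extChartAt_source (I := 𝓡 n) (γ 0)
  have db : chartCurve γ 0 ∈ coordDomain (n := n) (γ 0) (γ 0) (b • ·) :=
    extChartAt_mem_coordDomain h0 (by rwa [hb])
  have da : chartCurve γ u ∈ coordDomain (n := n) (γ 0) (γ 0) (a • ·) :=
    extChartAt_mem_coordDomain hu hau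
  have eb : coordRep (γ 0) (γ 0) (b • ·) (chartCurve γ 0) = chartCurve (n := n) γ u := by
    simp only [coordRep, chartCurve, (extChartAt (𝓡 n) (γ 0)).left_inv h0, hb]
  have ob := isOpen_coordDomain (n := n) (γ 0) (γ 0) (φ := (b • ·)) b.2.1.continuous
  have oa := isOpen_coordDomain (n := n) (γ 0) (γ 0) (φ := (a • ·)) a.2.1.continuous
  have hfb := ((contDiffOn_coordRep (γ 0) (γ 0) (φ := (b • ·)) b.2.1).contDiffAt
    (ob.mem_nhds db)).differentiableAt (by simp)
  have hfa := ((contDiffOn_coordRep (γ 0) (γ 0) (φ := (a • ·)) a.2.1).contDiffAt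
    (oa.mem_nhds da)).differentiableAt (by simp)
  rw [← eb] at hfa
  have heq : coordRep (γ 0) (γ 0) ((a * b) • ·) =ᶠ[𝓝 (chartCurve γ 0)]
      coordRep (n := n) (γ 0) (γ 0) (a • ·) ∘ coordRep (γ 0) (γ 0) (b • ·) := by
    filter_upwards [ob.mem_nhds db] with z hz
    have hz2 : b • (extChartAt (𝓡 n) (γ 0)).symm z ∈ (extChartAt (𝓡 n) (γ 0)).source := hz.2
    simp only [coordRep, Function.comp_apply, (extChartAt (𝓡 n) (γ 0)).left_inv hz2, mul_smul]
  rw [fderivAlong, heq.fderiv_eq, fderiv_comp _ hfa hfb, eb]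
  rfl

omit [IsManifold (𝓡 n) ∞ M] [IsContMDiffRiemannianBundle (𝓡 n) ∞ (EuclideanSpace ℝ (Fin n))
  (fun x : M => TangentSpace (𝓡 n) x)] in
lemma fderivAlong_one : fderivAlong (n := n) γ (((1 : Isom n M)) • ·) 0 = 1 := by
  have h0 := mem_extChartAt_target (I := 𝓡 n) (γ 0)
  have heq : coordRep (n := n) (γ 0) (γ 0) ((1 : Isom n M) • ·) =ᶠ[𝓝 (chartCurve γ 0)] id := by
    filter_upwards [(isOpen_extChartAt_target (I := 𝓡 n) (γ 0)).mem_nhds h0] with z hz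
    simp only [coordRep, one_smul, (extChartAt (𝓡 n) (γ 0)).right_inv hz, id]
  rw [fderivAlong, heq.fderiv_eq, fderiv_id]
  rfl

variable [IsRiemannianManifold (𝓡 n) M] [ConnectedSpace M]

/-- If isometries translate a smooth curve along itself, so does a one-parameter group. -/
theorem exists_oneParameter_translation (hγ : ContMDiff 𝓘(ℝ, ℝ) (𝓡 n) ∞ γ)
    (hη : ∀ s : ℝ, ∃ η : Isom n M, ∀ t : ℝ, η • γ t = γ (t + s)) :
    ∃ ψ : Multiplicative ℝ →ₜ* Isom n M, ∀ s t : ℝ, ψ (.ofAdd s) • γ t = γ (t + s) := by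
  obtain ⟨ε₀, hε₀, P, Q, hP0, hQ0, hPQ⟩ :=
    exists_fundamental_solution (contDiffAt_connectionAlong (n := n) hγ)
  have h0s := mem_extChartAt_source (I := 𝓡 n) (γ 0)
  obtain ⟨ε₁, hε₁, hsrc⟩ := Metric.eventually_nhds_iff.1
    ((isOpen_preimage_source (n := n) hγ.continuous).mem_nhds h0s)
  -- Halved so that sums of two shifts below ε stay where both the chart and P, Q are available.
  set ε := min ε₀ ε₁ / 2 with hε
  have hεpos : 0 < ε := half_pos (lt_min hε₀ hε₁)
  have h2ε₀ : 2 * ε ≤ ε₀ := by rw [hε]; linarith [min_le_left ε₀ ε₁]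
  have h2ε₁ : 2 * ε ≤ ε₁ := by rw [hε]; linarith [min_le_right ε₀ ε₁]
  have hsrc' : ∀ t, |t| < 2 * ε → γ t ∈ (extChartAt (𝓡 n) (γ 0)).source := fun t ht =>
    hsrc (by simpa using ht.trans_le h2ε₁)
  have hsrc1 : ∀ t, |t| < ε → γ t ∈ (extChartAt (𝓡 n) (γ 0)).source := fun t ht =>
    hsrc' t (by linarith)
  let s : translationGroup (n := n) γ → ℝ := fun g => g.1.2.toAdd
  -- The differential lands over γ(s g); Q is parallel transport back to γ 0, so the values of A can
  -- be multiplied.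
  let A : translationGroup (n := n) γ → (𝔼 →L[ℝ] 𝔼) := fun g =>
    Q (s g) * fderivAlong γ (g.1.1 • ·) 0
  have hsc : Continuous s := continuous_toAdd.comp (continuous_snd.comp continuous_subtype_val)
  have hg0 : ∀ g : translationGroup (n := n) γ, g.1.1 • γ 0 = γ (s g) := fun g => by
    rw [translationGroup_smul, zero_add]
  obtain ⟨ψ, hψc, hψs⟩ := exists_continuous_hom_section (s := s) (A := A) (ε := ε)
    (fun g h => rfl) hsc
    (fun r => by
      obtain ⟨a, ha⟩ := hη r
      exact ⟨⟨(a, .ofAdd r), ha⟩, rfl⟩)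
    (isCompact_translationGroup hγ.continuous) hεpos
    (by
      change Q 0 * fderivAlong γ ((1 : Isom n M) • ·) 0 = 1
      rw [hQ0, fderivAlong_one, one_mul])
    (fun g h hg hh _ => by
      have hgh : |s h + s g| < 2 * ε := (abs_add_le _ _).trans_lt (by linarith)
      have e1 : fderivAlong (n := n) γ ((g * h).1.1 • ·) 0 = _ :=
        fderivAlong_mul (a := g.1.1) (hg0 h) (hsrc1 _ hh) (by
          rw [translationGroup_smul]; exact hsrc' _ hgh)
      -- The transported differential of g is the same at γ(s h) as at γ 0. Inserting P Q = 1 at s h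
      -- between the two factors of the chain rule splits A(g h) into A(g) A(h).
      have e2 := conj_fundamental_solution_eq (F := fderivAlong (n := n) γ (g.1.1 • ·)) hεpos hg hP0
        (fun t ht => ⟨(hPQ t (ht.trans_le h2ε₀)).1, (hPQ t (ht.trans_le h2ε₀)).2.1⟩)
        (fun t ht => hasDerivAt_fderivAlong hγ (translationGroup_smul g) (hsrc1 t ht)
          (hsrc' _ ((abs_add_le _ _).trans_lt (by linarith [hg])))) hh
      have e3 : s (g * h) = s h + s g := add_comm _ _
      change Q (s (g * h)) * _ = _
      rw [e1, e3]
      change _ = Q (s g) * fderivAlong γ (g.1.1 • ·) 0 * (Q (s h) * fderivAlong γ (h.1.1 • ·) 0)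
      rw [← e2]
      have e4 := (hPQ (s h) (by linarith)).2.2
      calc _ = Q (s h + s g) * fderivAlong γ (g.1.1 • ·) (s h) * 1 *
            fderivAlong γ (h.1.1 • ·) 0 := by rw [mul_one, mul_assoc]
        _ = _ := by rw [← e4]; simp only [mul_assoc])
    (fun g hg => by
      have h1 : ContinuousAt (fun g => Q (s g)) g :=
        ContinuousAt.comp (f := s) (g := Q) (hPQ (s g) (by linarith)).2.1.continuousAt
          hsc.continuousAt
      have h2 : ContinuousAt (fun g : translationGroup (n := n) γ => fderivAlong (n := n) γ (g.1.1 • ·) 0) g :=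
        ContinuousAt.comp (f := fun g : translationGroup (n := n) γ => g.1.1)
          (g := fun a : Isom n M => fderivAlong (n := n) γ (a • ·) 0)
          (Isom.continuousAt_fderiv_coordRep h0s (by rw [hg0]; exact hsrc1 _ hg))
          (continuous_fst.comp continuous_subtype_val).continuousAt
      exact h1.mul h2)
    (fun g hg hA => by
      have h1 : fderivAlong (n := n) γ (g.1.1 • ·) 0 = 1 := by
        have : Q (s g) * fderivAlong (n := n) γ (g.1.1 • ·) 0 = 1 := hA
        rwa [hg, hQ0, one_mul] at this
      have h2 : g.1.1 • γ 0 = γ 0 := by rw [hg0, hg]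
      have h3 : g.1.1 = 1 := Isom.eq_of_fderiv_eq (x := γ 0) (by rw [h2, one_smul]) h0s
        (by rw [h2]; exact h0s) (h1.trans fderivAlong_one.symm)
      exact Subtype.ext (Prod.ext h3 hg))
  refine ⟨⟨(MonoidHom.fst _ _).comp ((translationGroup (n := n) γ).subtype.comp ψ),
    continuous_fst.comp (continuous_subtype_val.comp hψc)⟩, fun r t => ?_⟩
  have h1 := translationGroup_smul (ψ (.ofAdd r)) t
  have h2 : (ψ (.ofAdd r)).1.2.toAdd = r := hψs r
  rw [h2] at h1
  exact h1

end Holonomy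

end

/-! ### The geodesic as the orbit of its initial point -/

theorem mainTheorem1 (n : ℕ) (M : Type*) [EMetricSpace M] [ConnectedSpace M]
    [ChartedSpace (EuclideanSpace ℝ (Fin n)) M] [IsManifold (𝓡 n) ∞ M]
    [RiemannianBundle (fun x : M => TangentSpace (𝓡 n) x)]
    [IsContMDiffRiemannianBundle (𝓡 n) ∞ (EuclideanSpace ℝ (Fin n))
      (fun x : M => TangentSpace (𝓡 n) x)]
    [IsRiemannianManifold (𝓡 n) M]
    (γ : ℝ → M) (hγ : IsGeodesic n γ) (hγ1 : IsArcLength n γ)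
    (hη : ∀ s : ℝ, ∃ η : Isom n M, ∀ t : ℝ, η • γ t = γ (t + s)) :
    IsHomogeneous n γ := by
  obtain ⟨ψ, hψ⟩ := exists_oneParameter_translation hγ.1 hη
  refine ⟨ψ, γ 0, congrArg range (funext fun t => ?_)⟩
  rw [hψ, zero_add]
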